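/- **Setting.** Let $D$ be a real random variable with a continuous distribution function, $X$ a random vector in $\mathbb R^k$, $\varepsilon$ a random element of an arbitrary measurable space, and $m(d,x,e)$ a measurable real function that is continuously differentiable in $d$ for each $(x,e)$. For $t\in[0,1]$ let $\pi_t:\mathbb R\to\mathbb R$ be measurable with $\pi_0(d)=d$, $t\mapsto\pi_t(d)$ continuously differentiable at $t=0$ for each $d$, and $\dot\pi(d):=\partial_t\pi_t(d)|_{t=0}$ bounded. Put $Y=m(D,X,\varepsilon)$, $Y^t=m(\pi_t(D),X,\varepsilon)$, $\dot m(d,x,e)=\dot\pi(d)\,\partial_d m(d,x,e)$. Let $F_{Y^t}$, $F_Y$ be the distribution functions, $f_Y=F_Y'$, $Q_\tau(F)=\inf\{y:F(y)\ge\tau\}$, $q_\tau=Q_\tau(F_Y)$, and $$\theta_Q(\tau)=\lim_{t\downarrow0}\frac{Q_\tau(F_{Y^t})-Q_\tau(F_Y)}{t}.$$ Fix a regular conditional distribution of $\varepsilon$ given $(D,X)$. All conditional probabilities given $D=d,X=x$ below are computed from it; in particular $F_{Y|D,X}(y|d,x)=\mathbb P[m(d,x,\varepsilon)\le y\mid D=d,X=x]$,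 $f_{Y|D,X}=\partial_yF_{Y|D,X}$ and $Q_{Y|D,X}(\alpha|d,x)=\inf\{y:F_{Y|D,X}(y|d,x)\ge\alpha\}$. Derivatives in $d$ of $F_{Y|D,X}$ and $Q_{Y|D,X}$ are taken within $\operatorname{supp}(D)$. Let $\beta^{CQD}(\alpha,d,x)=\partial_dQ_{Y|D,X}(\alpha|d,x)$. **Assumptions.** 1. $\operatorname{supp}(Y)$ is a compact interval. On its interior $F_Y$ is continuously differentiable and $f_Y>0$. 2. $\dot m$ is measurable and, for every $\nu>0$, $\mathbb P\big[|m(\pi_t(D),X,\varepsilon)-m(D,X,\varepsilon)-t\,\dot m(D,X,\varepsilon)|\ge\nu t\big]=o(t)$ as $t\downarrow0$. 3. $(Y,\dot m(D,X,\varepsilon))$ has a density $f(y,y')$, continuous in $y$ on the interior of $\operatorname{supp}(Y)$ for each $y'$, with $f(y,y')\le C|g(y')|$ for all $(y,y')$, for some $C>0$ and some $g$ such that $g(y')$ and $y'g(y')$ are Lebesgue integrable. 4. For every $(d,x)\in\operatorname{supp}(D)\times\operatorname{supp}(X)$: (a) the conditional law of $Y$ given $(D,X)=(d,x)$ is absolutely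 continuous; on the interior of its support $F_{Y|D,X}(\cdot|d,x)$ is differentiable with positive, bounded and continuous derivative $f_{Y|D,X}(\cdot|d,x)$; $F_{Y|D,X}(y|d,x)$ is continuously differentiable in $d$ for each $y$; and $\partial_dQ_{Y|D,X}(\alpha|d,x)$ exists for every $\alpha\in(0,1)$ such that $Q_{Y|D,X}(\alpha|d,x)$ lies in that interior; (b) $\partial_dm(d,x,\cdot)$ is measurable and, for every $\nu>0$, $\mathbb P\big[|m(d+\delta,x,\varepsilon)-m(d,x,\varepsilon)-\delta\,\partial_dm(d,x,\varepsilon)|\ge\nu\delta\mid D=d,X=x\big]=o(\delta)$ as $\delta\downarrow0$; (c) the conditional law of $(Y,\partial_dm(d,x,\varepsilon))$ given $(D,X)=(d,x)$ has a density $f(y,y'|d,x)$, continuous in $y$ on the interior of $\operatorname{supp}(Y)$ for each $y'$, with $f(y,y'|d,x)\le C|g(y')|$ for all $(y,y')$, where $C>0$ and $g$ do not depend on $(d,x)$ and $g(y')$, $y'g(y')$ are Lebesgue integrable. 5. (Conditional independence $\varepsilon\perp D\mid X$.) For $(d,x)\in\operatorname{supp}(D)\times\operatorname{supp}(X)$ the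 conditional law of $\varepsilon$ given $(D,X)=(d,x)$ is a function of $x$ only. **Conclusion.** Let $\tau\in(0,1)$, let $\omega_y(d,x)=f_{Y|D,X}(y|d,x)/f_Y(y)$ and $\zeta_\tau(d,x)=\{\alpha\in(0,1):Q_{Y|D,X}(\alpha|d,x)=q_\tau\}$. For $(d,x)\in\operatorname{supp}(D)\times\operatorname{supp}(X)$ with $\omega_{q_\tau}(d,x)\ne0$ the set $\zeta_\tau(d,x)$ is a singleton, identified with its element (where $\omega_{q_\tau}(d,x)=0$ the second integrand below is $0$). The limit $\theta_Q(\tau)$ exists, all integrals below converge absolutely, and $$\theta_Q(\tau)=\frac{-1}{f_Y(q_\tau)}\int\dot\pi(d)\,\partial_dF_{Y|D,X}(q_\tau|d,x)\,dF_{D,X}(d,x)$$ $$=\int\dot\pi(d)\,\omega_{q_\tau}(d,x)\,\beta^{CQD}(\zeta_\tau(d,x),d,x)\,dF_{D,X}(d,x)$$ $$=\int\dot\pi(d)\,\beta^{CQD}(\zeta_\tau(d,x),d,x)\,dF_{D,X|Y}(d,x|q_\tau),$$ where $F_{D,X|Y}(\cdot|y)$ is the law $\lim_{h\downarrow0}\mathbb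 P[(D,X)\in\cdot\mid|Y-y|\le h]$ (the limit being taken for every measurable set); for $y=q_\tau$ this limit exists and is a probability measure. -/

import Mathlib

open MeasureTheory ProbabilityTheory Set Filter Topology Asymptotics

noncomputable section

/-- The quantile functional `Q_τ(F) = inf {y | F y ≥ τ}`. -/
def quantileOf (F : ℝ → ℝ) (τ : ℝ) : ℝ := sInf {y : ℝ | τ ≤ F y}

/-- `ν` is the conditional law of `W` given `Y = y`, for a continuously distributed `Y`:
`ν B = lim_{h ↓ 0} P(W ∈ B | |Y - y| ≤ h)` for every measurable set `B`.
This determines `ν` uniquely. -/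
def IsCondLawAt {Ω S : Type*} [MeasurableSpace Ω] [MeasurableSpace S] (P : Measure Ω)
    (Y : Ω → ℝ) (W : Ω → S) (y : ℝ) (ν : Measure S) : Prop :=
  IsProbabilityMeasure ν ∧
  ∀ B : Set S, MeasurableSet B →
    Tendsto (fun h : ℝ => (ProbabilityTheory.cond P (Y ⁻¹' Icc (y - h) (y + h))).real (W ⁻¹' B))
      (𝓝[>] 0) (𝓝 (ν.real B))

/-- The primitives of the nonseparable model: the policy variable `D`, the covariate vector `X`,
the unobserved disturbance `ε` (in an arbitrary measurable space), the structural function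
`m(d, x, e)`, the policy functions `π_t(d)`, and a kernel `κ`, which will be required to be a
regular conditional distribution of `ε` given `(D, X)`. -/
structure PolicyModel (Ω E : Type*) [MeasurableSpace Ω] [MeasurableSpace E] (k : ℕ) where
  D : Ω → ℝ
  X : Ω → (Fin k → ℝ)
  ε : Ω → E
  m : ℝ → (Fin k → ℝ) → E → ℝ
  π : ℝ → ℝ → ℝ
  κ : Kernel (ℝ × (Fin k → ℝ)) E

namespace PolicyModel

variable {Ω E : Type*} [MeasurableSpace Ω] [MeasurableSpace E] {k : ℕ}

/-- The counterfactual outcome `Y^t = m(π_t(D), X, ε)`. -/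
def Yt (M : PolicyModel Ω E k) (t : ℝ) (ω : Ω) : ℝ := M.m (M.π t (M.D ω)) (M.X ω) (M.ε ω)

/-- The status quo outcome `Y = m(D, X, ε)`. -/
def Y (M : PolicyModel Ω E k) (ω : Ω) : ℝ := M.m (M.D ω) (M.X ω) (M.ε ω)

/-- The pair `(D, X)`. -/
def DX (M : PolicyModel Ω E k) (ω : Ω) : ℝ × (Fin k → ℝ) := (M.D ω, M.X ω)

/-- The structural derivative `∂_d m(d, x, e)`. -/
def dm (M : PolicyModel Ω E k) (d : ℝ) (x : Fin k → ℝ) (e : E) : ℝ :=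
  deriv (fun d' => M.m d' x e) d

/-- `π̇(d)`, the derivative of `t ↦ π_t(d)` on `[0, 1]` at `t = 0`. -/
def πdot (M : PolicyModel Ω E k) (d : ℝ) : ℝ := derivWithin (fun t => M.π t d) (Icc 0 1) 0

/-- `ṁ(d, x, e) = π̇(d) ∂_d m(d, x, e)`. -/
def mdot (M : PolicyModel Ω E k) (d : ℝ) (x : Fin k → ℝ) (e : E) : ℝ := M.πdot d * M.dm d x e

/-- The support of `Y`. -/
def suppY (M : PolicyModel Ω E k) (P : Measure Ω) : Set ℝ := (P.map M.Y).support

/-- The support of `D`. -/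
def suppD (M : PolicyModel Ω E k) (P : Measure Ω) : Set ℝ := (P.map M.D).support

/-- The support of `X`. -/
def suppX (M : PolicyModel Ω E k) (P : Measure Ω) : Set (Fin k → ℝ) := (P.map M.X).support

/-- The distribution function `F_Y`. -/
def FY (M : PolicyModel Ω E k) (P : Measure Ω) (y : ℝ) : ℝ := cdf (P.map M.Y) y

/-- The distribution function `F_{Y^t}`. -/
def FYt (M : PolicyModel Ω E k) (P : Measure Ω) (t y : ℝ) : ℝ := cdf (P.map (M.Yt t)) y

/-- The density `f_Y = F_Y'`. -/
def fY (M : PolicyModel Ω E k) (P : Measure Ω) (y : ℝ) : ℝ := deriv (M.FY P) y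

/-- `q_τ = Q_Y(τ)`. -/
def q (M : PolicyModel Ω E k) (P : Measure Ω) (τ : ℝ) : ℝ := quantileOf (M.FY P) τ

/-- The conditional law of `Y` given `(D, X) = (d, x)`: the law of `m(d, x, ε)` when `ε` has its
conditional law given `(D, X) = (d, x)`. -/
def condLawY (M : PolicyModel Ω E k) (d : ℝ) (x : Fin k → ℝ) : Measure ℝ :=
  (M.κ (d, x)).map (M.m d x)

/-- The conditional law of `(Y, ∂_d m(d, x, ε))` given `(D, X) = (d, x)`. -/
def condLawYdm (M : PolicyModel Ω E k) (d : ℝ) (x : Fin k → ℝ) : Measure (ℝ × ℝ) :=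
  (M.κ (d, x)).map (fun e => (M.m d x e, M.dm d x e))

/-- The conditional distribution function `F_{Y|D,X}(y | d, x)`. -/
def FYDX (M : PolicyModel Ω E k) (y d : ℝ) (x : Fin k → ℝ) : ℝ := cdf (M.condLawY d x) y

/-- The conditional density `f_{Y|D,X}(y | d, x) = ∂_y F_{Y|D,X}(y | d, x)`. -/
def fYDX (M : PolicyModel Ω E k) (y d : ℝ) (x : Fin k → ℝ) : ℝ :=
  deriv (fun y' => M.FYDX y' d x) y

/-- `∂_d F_{Y|D,X}(y | d, x)`, the derivative being taken within the support of `D`. -/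
def dFYDX (M : PolicyModel Ω E k) (P : Measure Ω) (y d : ℝ) (x : Fin k → ℝ) : ℝ :=
  derivWithin (fun d' => M.FYDX y d' x) (M.suppD P) d

/-- The conditional quantile `Q_{Y|D,X}(α | d, x)`. -/
def QYDX (M : PolicyModel Ω E k) (α d : ℝ) (x : Fin k → ℝ) : ℝ :=
  quantileOf (fun y => M.FYDX y d x) α

/-- The conditional quantile derivative `β^CQD(α, d, x) = ∂_d Q_{Y|D,X}(α | d, x)`, the derivative
being taken within the support of `D`. -/
def βCQD (M : PolicyModel Ω E k) (P : Measure Ω) (α d : ℝ) (x : Fin k → ℝ) : ℝ :=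
  derivWithin (fun d' => M.QYDX α d' x) (M.suppD P) d

/-- The matching set `{α ∈ (0, 1) | Q_{Y|D,X}(α | d, x) = q_τ}`. -/
def matchSet (M : PolicyModel Ω E k) (P : Measure Ω) (τ d : ℝ) (x : Fin k → ℝ) : Set ℝ :=
  {α | α ∈ Ioo (0 : ℝ) 1 ∧ M.QYDX α d x = M.q P τ}

/-- The matching function `ζ_τ(d, x)`: the element of the matching set when that set is a
singleton. -/
def ζ (M : PolicyModel Ω E k) (P : Measure Ω) (τ d : ℝ) (x : Fin k → ℝ) : ℝ :=
  sSup (M.matchSet P τ d x)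

/-- The weight `ω_y(d, x) = f_{Y|D,X}(y | d, x) / f_Y(y)`. -/
def weight (M : PolicyModel Ω E k) (P : Measure Ω) (y d : ℝ) (x : Fin k → ℝ) : ℝ :=
  M.fYDX y d x / M.fY P y

/-- The structural assumptions. -/
structure Structural (M : PolicyModel Ω E k) (P : Measure Ω) : Prop where
  measurable_D : Measurable M.D
  measurable_X : Measurable M.X
  measurable_ε : Measurable M.ε
  measurable_m : Measurable (fun p : ℝ × (Fin k → ℝ) × E => M.m p.1 p.2.1 p.2.2)
  /-- `D` is continuously distributed. -/
  continuous_D : ∀ d : ℝ, P {ω | M.D ω = d} = 0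
  /-- `m` is continuously differentiable in `d`. -/
  contDiff_m : ∀ x e, ContDiff ℝ 1 (fun d => M.m d x e)
  measurable_π : ∀ t ∈ Icc (0 : ℝ) 1, Measurable (M.π t)
  π_zero : ∀ d, M.π 0 d = d
  /-- `π_t(d)` is continuously differentiable in `t` at `t = 0`. -/
  contDiff_π : ∀ d, ContDiffWithinAt ℝ 1 (fun t => M.π t d) (Icc 0 1) 0
  bounded_πdot : ∃ B : ℝ, ∀ d, |M.πdot d| ≤ B

/-- `κ(d, x)` is a regular conditional distribution of `ε` given `(D, X) = (d, x)`. -/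
structure IsCondLaw (M : PolicyModel Ω E k) (P : Measure Ω) : Prop where
  isMarkov : IsMarkovKernel M.κ
  map_eq : P.map (fun ω => (M.DX ω, M.ε ω)) = (P.map M.DX) ⊗ₘ M.κ

/-- Unconditional regularity conditions. -/
structure Regular (M : PolicyModel Ω E k) (P : Measure Ω) : Prop where
  /-- `F_Y` is continuously differentiable, with positive density, inside the support of `Y`. -/
  differentiable_FY : ∀ y ∈ interior (M.suppY P), DifferentiableAt ℝ (M.FY P) y
  continuous_fY : ContinuousOn (M.fY P) (interior (M.suppY P))
  pos_fY : ∀ y ∈ interior (M.suppY P), 0 < M.fY P y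
  measurable_mdot : Measurable (fun p : ℝ × (Fin k → ℝ) × E => M.mdot p.1 p.2.1 p.2.2)
  /-- First-order expansion of the counterfactual outcome in probability. -/
  expansion : ∀ ν : ℝ, 0 < ν →
    (fun t : ℝ => P.real {ω | ν * t ≤
      |M.m (M.π t (M.D ω)) (M.X ω) (M.ε ω) - M.m (M.D ω) (M.X ω) (M.ε ω)
        - t * M.mdot (M.D ω) (M.X ω) (M.ε ω)|}) =o[𝓝[>] 0] (fun t : ℝ => t)
  /-- `(Y, ṁ(D, X, ε))` has a density, continuous in its first argument and dominated. -/
  density : ∃ (f : ℝ → ℝ → ℝ) (g : ℝ → ℝ) (C : ℝ),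
    Measurable (Function.uncurry f) ∧ (∀ y y', 0 ≤ f y y') ∧
    P.map (fun ω => (M.Y ω, M.mdot (M.D ω) (M.X ω) (M.ε ω))) =
      (volume : Measure (ℝ × ℝ)).withDensity (fun z => ENNReal.ofReal (f z.1 z.2)) ∧
    (∀ y', ContinuousOn (fun y => f y y') (interior (M.suppY P))) ∧
    Integrable g ∧ Integrable (fun y' => y' * g y') ∧ 0 < C ∧
    ∀ y y', f y y' ≤ C * |g y'|

/-- Conditional regularity conditions, for all `(d, x)` in `supp D × supp X`. -/
structure CondRegular (M : PolicyModel Ω E k) (P : Measure Ω) : Prop where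
  /-- The conditional law of `Y` is absolutely continuous. -/
  absCont : ∀ d ∈ M.suppD P, ∀ x ∈ M.suppX P, M.condLawY d x ≪ volume
  /-- The conditional density exists and is positive, continuous and bounded inside the
  conditional support. -/
  differentiable_FYDX : ∀ d ∈ M.suppD P, ∀ x ∈ M.suppX P,
    ∀ y ∈ interior (M.condLawY d x).support, DifferentiableAt ℝ (fun y' => M.FYDX y' d x) y
  pos_fYDX : ∀ d ∈ M.suppD P, ∀ x ∈ M.suppX P,
    ∀ y ∈ interior (M.condLawY d x).support, 0 < M.fYDX y d x
  continuous_fYDX : ∀ d ∈ M.suppD P, ∀ x ∈ M.suppX P,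
    ContinuousOn (fun y => M.fYDX y d x) (interior (M.condLawY d x).support)
  bounded_fYDX : ∀ d ∈ M.suppD P, ∀ x ∈ M.suppX P, ∃ B : ℝ,
    ∀ y ∈ interior (M.condLawY d x).support, M.fYDX y d x ≤ B
  /-- `F_{Y|D,X}(y | d, x)` is continuously differentiable in `d`. -/
  differentiable_d : ∀ y, ∀ x ∈ M.suppX P,
    DifferentiableOn ℝ (fun d => M.FYDX y d x) (M.suppD P)
  continuous_d : ∀ y, ∀ x ∈ M.suppX P, ContinuousOn (fun d => M.dFYDX P y d x) (M.suppD P)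
  /-- The conditional quantile derivative exists at the interior conditional quantiles. -/
  differentiable_Q : ∀ d ∈ M.suppD P, ∀ x ∈ M.suppX P, ∀ α ∈ Ioo (0 : ℝ) 1,
    M.QYDX α d x ∈ interior (M.condLawY d x).support →
      DifferentiableWithinAt ℝ (fun d' => M.QYDX α d' x) (M.suppD P) d
  measurable_dm : ∀ d ∈ M.suppD P, ∀ x ∈ M.suppX P, Measurable (M.dm d x)
  /-- First-order expansion of the outcome in conditional probability. -/
  expansion : ∀ d ∈ M.suppD P, ∀ x ∈ M.suppX P, ∀ ν : ℝ, 0 < ν →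
    (fun δ : ℝ => (M.κ (d, x)).real {e | ν * δ ≤
      |M.m (d + δ) x e - M.m d x e - δ * M.dm d x e|}) =o[𝓝[>] 0] (fun δ : ℝ => δ)
  /-- `(Y, ∂_d m(d, x, ε))` has a conditional density, continuous in its first argument and
  dominated uniformly in `(d, x)`. -/
  density : ∃ (g : ℝ → ℝ) (C : ℝ),
    Integrable g ∧ Integrable (fun y' => y' * g y') ∧ 0 < C ∧
    ∀ d ∈ M.suppD P, ∀ x ∈ M.suppX P, ∃ f : ℝ → ℝ → ℝ,
      Measurable (Function.uncurry f) ∧ (∀ y y', 0 ≤ f y y') ∧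
      M.condLawYdm d x =
        (volume : Measure (ℝ × ℝ)).withDensity (fun z => ENNReal.ofReal (f z.1 z.2)) ∧
      (∀ y', ContinuousOn (fun y => f y y') (interior (M.suppY P))) ∧
      ∀ y y', f y y' ≤ C * |g y'|

/-- Conditional independence of `ε` and `D` given `X`: the conditional law of `ε` given
`(D, X) = (d, x)` is a conditional law given `X = x` alone. -/
def CondIndep (M : PolicyModel Ω E k) (P : Measure Ω) : Prop :=
  ∃ κ₀ : Kernel (Fin k → ℝ) E, ∀ d ∈ M.suppD P, ∀ x ∈ M.suppX P, M.κ (d, x) = κ₀ x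

/-- `θ` is the quantile marginal policy effect
`θ_Q(τ) = lim_{t ↓ 0} (Q_τ(F_{Y^t}) - Q_τ(F_Y)) / t`. -/
def IsQuantileMPE (M : PolicyModel Ω E k) (P : Measure Ω) (τ θ : ℝ) : Prop :=
  Tendsto (fun t : ℝ => (quantileOf (M.FYt P t) τ - quantileOf (M.FY P) τ) / t)
    (𝓝[>] 0) (𝓝 θ)

end PolicyModel

end

/-! Let `f` be the density of `(Y, ṁ)` and put `A = ∫ f q z dz`, which is `f_Y(q)`, and `B = ∫ z f q
z dz`. Since `Y^t` is `Y + t ṁ` up to `o(t)` in probability, `P(Y^t ≤ q + t s) = τ + t (s A - B) +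
o(t)` for every `s` (`tendsto_perturbation`). The sign of `s A - B` decides on which side of `q + t
s` the quantile of `Y^t` lies, so the quantile moves at speed `B / A` (`tendsto_quantileOf_slope`).

The same two lemmas apply conditionally on `(d, x)`. By conditional independence, moving `d` changes
the structural function but not the law of `ε`. Hence `∂_d F_{Y|D,X} = -B(d, x)`, and the quantile
derivative at the matched level is `B(d, x) / A(d, x)`. The conditional expansion is one-sided, so
this is read off only at points of `supp D` accumulated from the right; the remaining points are
countable, hence null for the atomless law of `D`.

The two levels are linked by differentiating `P(Y ≤ q - t ṁ)` at `t = 0` twice: directly, giving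
`-B`, and after disintegration over `(D, X)`, giving `∫ π̇ ∂_d F_{Y|D,X}` by dominated convergence
(`integral_πdot_mul_dFYDX`). This yields the first form, and the matching identity `fYDX_mul_βCQD`
the second. For the third, Bayes' rule on shrinking windows (`tendsto_window_DX`) shows that the
weight is the density of the law of `(D, X)` given `Y = q_τ`. -/

theorem real_map_prodMk_le {Ω : Type*} [MeasurableSpace Ω] {μ : Measure Ω} {V Z : Ω → ℝ}
    (hV : Measurable V) (hZ : Measurable Z) {a : ℝ → ℝ} (ha : Measurable a) :
    (μ.map fun ω => (V ω, Z ω)).real {p | p.1 ≤ a p.2} = μ.real {ω | V ω ≤ a (Z ω)} := by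
  have hS : MeasurableSet {p : ℝ × ℝ | p.1 ≤ a p.2} :=
    measurableSet_le measurable_fst (ha.comp measurable_snd)
  rw [map_measureReal_apply (hV.prodMk hZ) hS]
  rfl

/-! ### Dominated joint densities and first-order expansions of distribution functions -/

/-- `ρ` has the density `f`, which is continuous in its first argument at `q` and dominated by
`C * |g|` for some `g` with `g` and `z * g z` integrable. -/
structure IsDominatedDensityAt (ρ : Measure (ℝ × ℝ)) (f : ℝ → ℝ → ℝ) (g : ℝ → ℝ) (C q : ℝ) :
    Prop where
  measurable : Measurable (Function.uncurry f)
  nonneg : ∀ y z, 0 ≤ f y z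
  eq_withDensity : ρ = (volume : Measure (ℝ × ℝ)).withDensity (fun p => ENNReal.ofReal (f p.1 p.2))
  continuousAt : ∀ z, ContinuousAt (fun y => f y z) q
  integrable_g : Integrable g
  integrable_mul_g : Integrable (fun z => z * g z)
  le : ∀ y z, f y z ≤ C * |g z|

namespace IsDominatedDensityAt

variable {ρ : Measure (ℝ × ℝ)} {f : ℝ → ℝ → ℝ} {g : ℝ → ℝ} {C q : ℝ}

theorem measurable_left (h : IsDominatedDensityAt ρ f g C q) (z : ℝ) :
    Measurable (fun y => f y z) :=
  h.measurable.comp (measurable_id.prodMk measurable_const)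

theorem measurable_right (h : IsDominatedDensityAt ρ f g C q) (y : ℝ) : Measurable (f y) :=
  h.measurable.comp (measurable_const.prodMk measurable_id)

theorem integrable_density (h : IsDominatedDensityAt ρ f g C q) [IsFiniteMeasure ρ] :
    Integrable (fun p : ℝ × ℝ => f p.1 p.2) := by
  refine ⟨h.measurable.aestronglyMeasurable, ?_⟩
  rw [hasFiniteIntegral_iff_ofReal (f := fun p : ℝ × ℝ => f p.1 p.2) (ae_of_all _ fun p => h.nonneg p.1 p.2)]
  have := measure_lt_top ρ univ
  rw [h.eq_withDensity, withDensity_apply _ MeasurableSet.univ, Measure.restrict_univ] at this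
  exact this

theorem integrable_mul_right (h : IsDominatedDensityAt ρ f g C q) {b : ℝ → ℝ} (hb : Measurable b)
    (hbg : Integrable (fun z => b z * g z)) (y : ℝ) : Integrable (fun z => b z * f y z) := by
  refine (hbg.norm.const_mul C).mono' (hb.mul (h.measurable_right y)).aestronglyMeasurable
    (ae_of_all _ fun z => ?_)
  rw [norm_mul, norm_mul, Real.norm_of_nonneg (h.nonneg y z), Real.norm_eq_abs (g z)]
  nlinarith [h.le y z, norm_nonneg (b z)]

theorem integrable_right (h : IsDominatedDensityAt ρ f g C q) (y : ℝ) : Integrable (f y) := by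
  simpa using h.integrable_mul_right (b := fun _ => 1) measurable_const
    (by simpa using h.integrable_g) y

theorem integrable_id_mul_right (h : IsDominatedDensityAt ρ f g C q) (y : ℝ) :
    Integrable (fun z => z * f y z) :=
  h.integrable_mul_right measurable_id h.integrable_mul_g y

theorem measureReal_eq (h : IsDominatedDensityAt ρ f g C q) {S : Set (ℝ × ℝ)}
    (hS : MeasurableSet S) : ρ.real S = ∫ p in S, f p.1 p.2 := by
  rw [measureReal_def, h.eq_withDensity, withDensity_apply _ hS,
    integral_eq_lintegral_of_nonneg_ae (f := fun p : ℝ × ℝ => f p.1 p.2)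
      (ae_of_all _ fun p => h.nonneg p.1 p.2)
      h.measurable.aestronglyMeasurable]

/-- Fubini, integrating in `y` first. The oriented interval integral carries the right sign whether
`a z` lies above or below `q`. -/
theorem measureReal_sub_eq (h : IsDominatedDensityAt ρ f g C q) [IsFiniteMeasure ρ]
    {a : ℝ → ℝ} (ha : Measurable a) :
    Integrable (fun z => ∫ y in q..a z, f y z) ∧
    ρ.real {p | p.1 ≤ a p.2} - ρ.real {p | p.1 ≤ q} = ∫ z, ∫ y in q..a z, f y z := by
  have hS : MeasurableSet {p : ℝ × ℝ | p.1 ≤ a p.2} :=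
    measurableSet_le measurable_fst (ha.comp measurable_snd)
  have hT : MeasurableSet {p : ℝ × ℝ | p.1 ≤ q} :=
    measurableSet_le measurable_fst measurable_const
  have hi := h.integrable_density
  have hd := (hi.indicator hS).sub (hi.indicator hT)
  rw [Measure.volume_eq_prod] at hd hi
  have key : (fun z => ∫ y, (indicator {p : ℝ × ℝ | p.1 ≤ a p.2} (fun p => f p.1 p.2) -
      indicator {p : ℝ × ℝ | p.1 ≤ q} (fun p => f p.1 p.2)) (y, z)) =ᵐ[volume]
      fun z => ∫ y in q..a z, f y z := by
    filter_upwards [hi.prod_left_ae] with z hz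
    rw [← intervalIntegral.integral_Iic_sub_Iic hz.integrableOn hz.integrableOn,
      ← integral_indicator measurableSet_Iic, ← integral_indicator measurableSet_Iic,
      ← integral_sub (hz.indicator measurableSet_Iic) (hz.indicator measurableSet_Iic)]
    rfl
  refine ⟨hd.integral_prod_right.congr key, ?_⟩
  rw [h.measureReal_eq hS, h.measureReal_eq hT, ← integral_indicator hS, ← integral_indicator hT,
    ← integral_congr_ae key, ← integral_prod_symm _ hd, Measure.volume_eq_prod]
  exact (integral_sub (hi.indicator hS) (hi.indicator hT)).symm

theorem norm_intervalIntegral_le (h : IsDominatedDensityAt ρ f g C q) (t b z : ℝ) :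
    ‖∫ y in q..q + t * b, f y z‖ ≤ |t| * (C * ‖b * g z‖) := by
  refine (intervalIntegral.norm_integral_le_of_norm_le_const (C := C * |g z|)
    fun y _ => ?_).trans_eq ?_
  · rw [Real.norm_of_nonneg (h.nonneg y z)]
    exact h.le y z
  · rw [add_sub_cancel_left, abs_mul, norm_mul, Real.norm_eq_abs, Real.norm_eq_abs]
    ring

/-- The constant depends only on `C`, `g` and `b`. In the model `C` and `g` are common to all `(d,
x)`, so this dominates the conditional difference quotients. -/
theorem abs_shift_sub_le (h : IsDominatedDensityAt ρ f g C q) [IsFiniteMeasure ρ] {b : ℝ → ℝ}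
    (hb : Measurable b) (hbg : Integrable (fun z => b z * g z)) (t : ℝ) :
    |ρ.real {p | p.1 ≤ q + t * b p.2} - ρ.real {p | p.1 ≤ q}| ≤
      |t| * (C * ∫ z, ‖b z * g z‖) := by
  obtain ⟨-, h2⟩ := h.measureReal_sub_eq (a := fun z => q + t * b z) (by fun_prop)
  rw [h2, ← integral_const_mul, ← integral_const_mul, ← Real.norm_eq_abs]
  exact norm_integral_le_of_norm_le ((hbg.norm.const_mul C).const_mul |t|)
    (ae_of_all _ fun z => h.norm_intervalIntegral_le t (b z) z)

/-- The derivative at `t = 0` of `ρ {(y, z) | y ≤ q + t b(z)}`. -/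
theorem tendsto_shift (h : IsDominatedDensityAt ρ f g C q) [IsFiniteMeasure ρ] {b : ℝ → ℝ}
    (hb : Measurable b) (hbg : Integrable (fun z => b z * g z)) :
    Tendsto (fun t : ℝ => (ρ.real {p | p.1 ≤ q + t * b p.2} - ρ.real {p | p.1 ≤ q}) / t)
      (𝓝[≠] 0) (𝓝 (∫ z, b z * f q z)) := by
  have heq : (fun t : ℝ => (ρ.real {p | p.1 ≤ q + t * b p.2} - ρ.real {p | p.1 ≤ q}) / t) =
      fun t => ∫ z, (∫ y in q..q + t * b z, f y z) / t := by
    ext t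
    rw [(h.measureReal_sub_eq (a := fun z => q + t * b z) (by fun_prop)).2, integral_div]
  rw [heq]
  refine tendsto_integral_filter_of_dominated_convergence (fun z => C * ‖b z * g z‖) ?_ ?_
    (hbg.norm.const_mul C) (ae_of_all _ fun z => ?_)
  · exact Eventually.of_forall fun t =>
      ((h.measureReal_sub_eq (a := fun z => q + t * b z)
        (by fun_prop)).1.div_const t).aestronglyMeasurable
  · filter_upwards [self_mem_nhdsWithin] with t ht
    refine ae_of_all _ fun z => ?_
    rw [norm_div, Real.norm_eq_abs t, div_le_iff₀ (abs_pos.2 ht), mul_comm (C * _)]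
    exact h.norm_intervalIntegral_le t (b z) z
  -- For fixed `z` the limit is the fundamental theorem of calculus at `q`, composed with the affine
  -- shift `q + t * b z`.
  · have h1 : HasDerivAt (fun u => ∫ y in q..u, f y z) (f q z) q :=
      intervalIntegral.integral_hasDerivAt_right (by simp)
        (h.measurable_left z).stronglyMeasurable.stronglyMeasurableAtFilter (h.continuousAt z)
    have h2 : HasDerivAt (fun t : ℝ => q + t * b z) (b z) 0 := by
      simpa using ((hasDerivAt_id (0 : ℝ)).mul_const (b z)).const_add q
    have h3 := HasDerivAt.comp (0 : ℝ) (h₂ := fun u => ∫ y in q..u, f y z) (by simpa using h1) h2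
    have h4 := hasDerivAt_iff_tendsto_slope_zero.1 h3
    simp only [Function.comp_def, zero_add, zero_mul, add_zero, intervalIntegral.integral_same,
      sub_zero, smul_eq_mul] at h4
    rw [mul_comm (b z)]
    refine h4.congr fun t => ?_
    rw [div_eq_inv_mul]

theorem integral_sub_mul (h : IsDominatedDensityAt ρ f g C q) (s : ℝ) :
    ∫ z, (s - z) * f q z = s * (∫ z, f q z) - ∫ z, z * f q z := by
  simp_rw [sub_mul]
  rw [integral_sub ((h.integrable_right q).const_mul s) (h.integrable_id_mul_right q),
    integral_const_mul]

/-- The first marginal has derivative `∫ f q z dz` at `q`. -/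
theorem hasDerivAt_marginal (h : IsDominatedDensityAt ρ f g C q) [IsFiniteMeasure ρ] :
    HasDerivAt (fun y => ρ.real {p | p.1 ≤ y}) (∫ z, f q z) q := by
  rw [hasDerivAt_iff_tendsto_slope_zero]
  have := h.tendsto_shift (b := fun _ => 1) measurable_const (by simpa using h.integrable_g)
  simpa [div_eq_inv_mul] using this

theorem integral_right_nonneg (h : IsDominatedDensityAt ρ f g C q) : 0 ≤ ∫ z, f q z :=
  integral_nonneg fun z => h.nonneg q z

/-- A nonnegative `f q` with zero integral vanishes almost everywhere. This settles the points `(d,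
x)` of zero weight. -/
theorem integral_id_mul_eq_zero (h : IsDominatedDensityAt ρ f g C q) (h0 : ∫ z, f q z = 0) :
    ∫ z, z * f q z = 0 := by
  rw [integral_eq_zero_iff_of_nonneg (fun z => h.nonneg q z) (h.integrable_right q)] at h0
  refine integral_eq_zero_of_ae ?_
  filter_upwards [h0] with z hz
  simp [hz]

theorem continuousAt_integral_right (h : IsDominatedDensityAt ρ f g C q) :
    ContinuousAt (fun y => ∫ z, f y z) q := by
  refine continuousAt_of_dominated (bound := fun z => C * |g z|)
    (Eventually.of_forall fun y => (h.measurable_right y).aestronglyMeasurable)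
    (Eventually.of_forall fun y => ae_of_all _ fun z => ?_) (h.integrable_g.abs.const_mul C)
    (ae_of_all _ fun z => h.continuousAt z)
  rw [Real.norm_of_nonneg (h.nonneg y z)]
  exact h.le y z

theorem map_fst_absolutelyContinuous (h : IsDominatedDensityAt ρ f g C q) :
    ρ.map Prod.fst ≪ volume := by
  have h1 : ρ ≪ (volume : Measure (ℝ × ℝ)) := by
    rw [h.eq_withDensity]; exact withDensity_absolutelyContinuous _ _
  exact (h1.map measurable_fst).trans Measure.quasiMeasurePreserving_fst.absolutelyContinuous

/-- The first marginal has no atoms, so the closed window may be made half-open. It is then a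
difference of the shifts with `b = 1` and `b = -1`. -/
theorem real_window_eq (h : IsDominatedDensityAt ρ f g C q) [IsFiniteMeasure ρ] {t : ℝ}
    (ht : 0 < t) : ρ.real {p | p.1 ∈ Icc (q - t) (q + t)} =
      (ρ.real {p | p.1 ≤ q + t * 1} - ρ.real {p | p.1 ≤ q}) -
        (ρ.real {p | p.1 ≤ q + t * (-1)} - ρ.real {p | p.1 ≤ q}) := by
  have hle (a : ℝ) : ρ.real {p | p.1 ≤ a} = (ρ.map Prod.fst).real (Iic a) := by
    rw [map_measureReal_apply measurable_fst measurableSet_Iic]; rfl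
  have hIcc : ρ.real {p | p.1 ∈ Icc (q - t) (q + t)} =
      (ρ.map Prod.fst).real (Icc (q - t) (q + t)) := by
    rw [map_measureReal_apply measurable_fst measurableSet_Icc]; rfl
  have : NullSingletonClass (ρ.map Prod.fst) := ⟨fun x => h.map_fst_absolutelyContinuous (by simp)⟩
  rw [hle, hle, hle, hIcc, measureReal_congr Ioc_ae_eq_Icc.symm, sub_sub_sub_cancel_right,
    ← measureReal_sdiff (Iic_subset_Iic.2 (by linarith)) measurableSet_Iic]
  congr 1
  ext x
  simp only [mem_Ioc, Set.mem_sdiff, mem_Iic, not_le]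
  constructor <;> rintro ⟨h1, h2⟩ <;> constructor <;> linarith

theorem real_window_le (h : IsDominatedDensityAt ρ f g C q) [IsFiniteMeasure ρ] {t : ℝ}
    (ht : 0 < t) : ρ.real {p | p.1 ∈ Icc (q - t) (q + t)} ≤ 2 * t * (C * ∫ z, ‖g z‖) := by
  have h1 := h.abs_shift_sub_le (b := fun _ => 1) measurable_const
    (by simpa using h.integrable_g) t
  have h2 := h.abs_shift_sub_le (b := fun _ => -1) measurable_const
    (by simpa using h.integrable_g) t
  simp only [one_mul, neg_one_mul, norm_neg, abs_of_pos ht] at h1 h2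
  rw [h.real_window_eq ht]
  linarith [(abs_le.1 h1).2, (abs_le.1 h2).1]

/-- The symmetric window density at `q`. -/
theorem tendsto_window (h : IsDominatedDensityAt ρ f g C q) [IsFiniteMeasure ρ] :
    Tendsto (fun t : ℝ => ρ.real {p | p.1 ∈ Icc (q - t) (q + t)} / (2 * t)) (𝓝[>] 0)
      (𝓝 (∫ z, f q z)) := by
  have h1 := h.tendsto_shift (b := fun _ => 1) measurable_const
    (by simpa using h.integrable_g)
  have h2 := h.tendsto_shift (b := fun _ => -1) measurable_const
    (by simpa using h.integrable_g)
  have h3 := ((h1.sub h2).div_const 2).mono_left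
    (nhdsWithin_mono (0 : ℝ) fun t (ht : 0 < t) => ne_of_gt ht)
  simp only [one_mul, neg_one_mul, integral_neg, sub_neg_eq_add, add_self_div_two] at h3
  refine h3.congr' ?_
  filter_upwards [self_mem_nhdsWithin] with t ht
  rw [h.real_window_eq ht, ← sub_div, div_div, mul_comm t 2]

section Perturbation

variable {Ω : Type*} [MeasurableSpace Ω] {μ : Measure Ω} {V Z : Ω → ℝ}

/-- Expansion of the distribution function of a first-order perturbation `W t ≈ V + t Z`. -/
theorem tendsto_perturbation [IsProbabilityMeasure μ]
    (h : IsDominatedDensityAt (μ.map fun ω => (V ω, Z ω)) f g C q)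
    (hV : Measurable V) (hZ : Measurable Z) {W : ℝ → Ω → ℝ}
    (hW : ∀ ν : ℝ, 0 < ν →
      (fun t : ℝ => μ.real {ω | ν * t ≤ |W t ω - V ω - t * Z ω|}) =o[𝓝[>] 0] (fun t : ℝ => t))
    (s : ℝ) :
    Tendsto (fun t : ℝ => (μ.real {ω | W t ω ≤ q + t * s} - μ.real {ω | V ω ≤ q}) / t)
      (𝓝[>] 0) (𝓝 (s * (∫ z, f q z) - ∫ z, z * f q z)) := by
  have : IsProbabilityMeasure (μ.map fun ω => (V ω, Z ω)) :=
    Measure.isProbabilityMeasure_map (hV.prodMk hZ).aemeasurable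
  have hlin (r : ℝ) : Tendsto (fun t : ℝ =>
      (μ.real {ω | V ω ≤ q + t * (r - Z ω)} - μ.real {ω | V ω ≤ q}) / t)
      (𝓝[>] 0) (𝓝 (r * (∫ z, f q z) - ∫ z, z * f q z)) := by
    have h1 := h.tendsto_shift (b := fun z => r - z) (by fun_prop)
      (by
        simp_rw [sub_mul]
        exact (h.integrable_g.const_mul r).sub h.integrable_mul_g)
    rw [h.integral_sub_mul] at h1
    refine (h1.mono_left (nhdsWithin_mono _ fun t ht => ne_of_gt ht)).congr fun t => ?_
    rw [real_map_prodMk_le hV hZ (a := fun z => q + t * (r - z)) (by fun_prop),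
      real_map_prodMk_le hV hZ (a := fun _ => q) measurable_const]
  have hbad (ν : ℝ) (hν : 0 < ν) : Tendsto (fun t : ℝ =>
      μ.real {ω | ν * t ≤ |W t ω - V ω - t * Z ω|} / t) (𝓝[>] 0) (𝓝 0) :=
    (hW ν hν).tendsto_div_nhds_zero
  have hA := h.integral_right_nonneg
  set A := ∫ z, f q z
  set B := ∫ z, z * f q z
  refine tendsto_order.2 ⟨fun a ha => ?_, fun a ha => ?_⟩
  -- Off an event of probability `o(t)`, `W t` is within `ν t` of `V + t Z`, so its distribution
  -- function is squeezed between the exact shifts with `s - ν` and `s + ν`. The `0` is the limit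
  -- contributed by the exceptional event.
  · obtain ⟨ν, hν, hνa⟩ : ∃ ν > 0, a < (s - ν) * A - B - 0 := by
      -- Chosen so that `ν A` is below the gap `s A - B - a`; the `+ 1` allows `A = 0`.
      refine ⟨(s * A - B - a) / (2 * (A + 1)), by apply div_pos <;> linarith, ?_⟩
      have : (s * A - B - a) / (2 * (A + 1)) * A < s * A - B - a := by
        rw [div_mul_eq_mul_div, div_lt_iff₀ (by linarith)]
        nlinarith
      linarith
    filter_upwards [((hlin (s - ν)).sub (hbad ν hν)).eventually (lt_mem_nhds hνa),
      self_mem_nhdsWithin] with t ht ht0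
    refine ht.trans_le ?_
    rw [← sub_div]
    refine div_le_div_of_nonneg_right ?_ (le_of_lt ht0)
    have hsub : {ω | V ω ≤ q + t * (s - ν - Z ω)} ⊆
        {ω | W t ω ≤ q + t * s} ∪ {ω | ν * t ≤ |W t ω - V ω - t * Z ω|} := by
      intro ω hω
      by_contra hc
      simp only [mem_union, mem_ofPred_eq, not_or, not_le] at hc hω
      have := (abs_lt.1 hc.2).2
      nlinarith [hc.1]
    have := (measureReal_mono (μ := μ) hsub).trans (measureReal_union_le _ _)
    linarith
  · obtain ⟨ν, hν, hνa⟩ : ∃ ν > 0, (s + ν) * A - B + 0 < a := by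
      refine ⟨(a - (s * A - B)) / (2 * (A + 1)), by apply div_pos <;> linarith, ?_⟩
      have : (a - (s * A - B)) / (2 * (A + 1)) * A < a - (s * A - B) := by
        rw [div_mul_eq_mul_div, div_lt_iff₀ (by linarith)]
        nlinarith
      linarith
    filter_upwards [((hlin (s + ν)).add (hbad ν hν)).eventually (gt_mem_nhds hνa),
      self_mem_nhdsWithin] with t ht ht0
    refine lt_of_le_of_lt ?_ ht
    rw [← add_div]
    refine div_le_div_of_nonneg_right ?_ (le_of_lt ht0)
    have hsub : {ω | W t ω ≤ q + t * s} ⊆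
        {ω | V ω ≤ q + t * (s + ν - Z ω)} ∪ {ω | ν * t ≤ |W t ω - V ω - t * Z ω|} := by
      intro ω hω
      by_contra hc
      simp only [mem_union, mem_ofPred_eq, not_or, not_le] at hc hω
      have := (abs_lt.1 hc.2).1
      nlinarith [hc.1]
    have := (measureReal_mono (μ := μ) hsub).trans (measureReal_union_le _ _)
    linarith

end Perturbation

end IsDominatedDensityAt

/-! ### Quantiles of distribution functions and their derivatives -/

section Quantile

variable {μ : Measure ℝ} {α q y : ℝ}

theorem quantileOf_cdf_le (hα : 0 < α) (h : α ≤ cdf μ y) : quantileOf (cdf μ) α ≤ y := by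
  refine csInf_le ?_ h
  obtain ⟨b, hb⟩ := ((tendsto_cdf_atBot μ).eventually (gt_mem_nhds hα)).exists
  refine ⟨b, fun z hz => ?_⟩
  by_contra! hc
  exact (((monotone_cdf μ) hc.le).trans_lt hb).not_ge hz

theorem le_quantileOf_cdf (hα : α < 1) (h : cdf μ y < α) : y ≤ quantileOf (cdf μ) α := by
  obtain ⟨b, hb⟩ := ((tendsto_cdf_atTop μ).eventually (lt_mem_nhds hα)).exists
  refine le_csInf ⟨b, hb.le⟩ fun z hz => ?_
  by_contra! hc
  exact (h.trans_le hz).not_ge ((monotone_cdf μ) hc.le)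

theorem cdf_quantileOf (hα : α ∈ Ioo (0 : ℝ) 1)
    (hc : ContinuousAt (cdf μ) (quantileOf (cdf μ) α)) :
    cdf μ (quantileOf (cdf μ) α) = α := by
  refine le_antisymm ?_ ?_
  · refine le_of_tendsto (hc.tendsto.mono_left (nhdsWithin_le_nhds (s := Iio (quantileOf (cdf μ) α)))) ?_
    filter_upwards [self_mem_nhdsWithin] with y hy
    by_contra! h
    exact (quantileOf_cdf_le hα.1 h.le).not_gt hy
  · refine ge_of_tendsto (hc.tendsto.mono_left (nhdsWithin_le_nhds (s := Ioi (quantileOf (cdf μ) α)))) ?_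
    filter_upwards [self_mem_nhdsWithin] with y hy
    by_contra! h
    exact (le_quantileOf_cdf hα.2 h).not_gt hy

theorem continuous_cdf_of_nullSingleton [IsProbabilityMeasure μ] [NullSingletonClass μ] : Continuous (cdf μ) := by
  rw [continuous_iff_continuousAt]
  intro x
  rw [continuousAt_iff_continuous_left'_right']
  refine ⟨?_, ((cdf μ).right_continuous x).mono Ioi_subset_Ici_self⟩
  rw [(monotone_cdf μ).continuousWithinAt_Iio_iff_leftLim_eq]
  refine le_antisymm ((monotone_cdf μ).leftLim_le le_rfl) ?_
  have h := StieltjesFunction.measure_singleton (cdf μ) x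
  rw [measure_cdf, measure_singleton] at h
  linarith [ENNReal.ofReal_eq_zero.1 h.symm]

/-- Positive slopes give strictness near `q`, and monotonicity extends it to all `y`. -/
theorem cdf_lt_cdf_of_hasDerivAt {c : ℝ} (h : HasDerivAt (cdf μ) c q) (hc : 0 < c) :
    (∀ y < q, cdf μ y < cdf μ q) ∧ ∀ y > q, cdf μ q < cdf μ y := by
  have hev := (hasDerivAt_iff_tendsto_slope.1 h).eventually (lt_mem_nhds hc)
  constructor
  · intro y hy
    have h1 : ∀ᶠ z in 𝓝[<] q, 0 < slope (cdf μ) q z :=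
      hev.filter_mono (nhdsWithin_mono _ fun z hz => ne_of_lt hz)
    obtain ⟨z, hz, hyz, hzq⟩ := (h1.and (Ioo_mem_nhdsLT hy)).exists
    have hz' : cdf μ z < cdf μ q := by
      by_contra! hc'
      rw [slope_def_field] at hz
      exact hz.not_ge (div_nonpos_of_nonneg_of_nonpos (sub_nonneg.2 hc') (sub_neg.2 hzq).le)
    exact ((monotone_cdf μ) hyz.le).trans_lt hz'
  · intro y hy
    have h1 : ∀ᶠ z in 𝓝[>] q, 0 < slope (cdf μ) q z :=
      hev.filter_mono (nhdsWithin_mono _ fun z hz => ne_of_gt hz)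
    obtain ⟨z, hz, hqz, hzy⟩ := (h1.and (Ioo_mem_nhdsGT hy)).exists
    rw [slope_def_field, div_pos_iff_of_pos_right (sub_pos.2 hqz), sub_pos] at hz
    exact hz.trans_le ((monotone_cdf μ) hzy.le)

/-- Where a distribution function has a positive derivative, exactly one quantile level is
attained. -/
theorem setOf_quantileOf_eq_of_hasDerivAt {c : ℝ} (h : HasDerivAt (cdf μ) c q) (hc : 0 < c) :
    {α | α ∈ Ioo (0 : ℝ) 1 ∧ quantileOf (cdf μ) α = q} = {cdf μ q} := by
  obtain ⟨hl, hr⟩ := cdf_lt_cdf_of_hasDerivAt h hc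
  refine Subset.antisymm ?_ ?_
  · rintro α ⟨hα, rfl⟩
    exact (cdf_quantileOf hα h.continuousAt).symm
  · rintro _ rfl
    have h0 : cdf μ q ∈ Ioo (0 : ℝ) 1 :=
      ⟨(cdf_nonneg μ (q - 1)).trans_lt (hl _ (by linarith)),
        (hr _ (lt_add_one q)).trans_le (cdf_le_one μ (q + 1))⟩
    exact ⟨h0, le_antisymm (quantileOf_cdf_le h0.1 le_rfl)
      (le_of_forall_lt fun y hy => by
        obtain ⟨z, hyz, hzq⟩ := exists_between hy
        exact hyz.trans_le (le_quantileOf_cdf h0.2 (hl z hzq)))⟩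

/-- A null neighbourhood of `q` would make the distribution function flat just to the right of `q`.
-/
theorem mem_support_of_hasDerivAt_cdf [IsProbabilityMeasure μ] {c : ℝ}
    (h : HasDerivAt (cdf μ) c q) (hc : 0 < c) : q ∈ μ.support := by
  by_contra hq
  obtain ⟨U, hU, hμU⟩ := Measure.notMem_support_iff_exists.1 hq
  obtain ⟨hl, hr⟩ := cdf_lt_cdf_of_hasDerivAt h hc
  obtain ⟨u, hu, hqu⟩ := exists_Ico_subset_of_mem_nhds hU ⟨q + 1, lt_add_one q⟩
  obtain ⟨z, hqz, hzu⟩ := exists_between hu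
  have h0 : (cdf μ).measure (Ioc q z) = 0 := by
    rw [measure_cdf]
    exact measure_mono_null (fun x hx => hqu ⟨hx.1.le, hx.2.trans_lt hzu⟩) hμU
  rw [StieltjesFunction.measure_Ioc, ENNReal.ofReal_eq_zero] at h0
  linarith [hr z hqz]

/-- The distribution function is `0` at the least point of the support and `1` at the greatest, so a
level in `(0, 1)` is attained strictly between them. -/
theorem quantileOf_cdf_mem_interior_support [IsProbabilityMeasure μ] [NullSingletonClass μ]
    (hcomp : IsCompact μ.support) (hord : μ.support.OrdConnected) (hα : α ∈ Ioo (0 : ℝ) 1) :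
    quantileOf (cdf μ) α ∈ interior μ.support := by
  have hne : μ.support.Nonempty := Measure.nonempty_support (IsProbabilityMeasure.ne_zero μ)
  obtain ⟨a, ha, haL⟩ := hcomp.exists_isLeast hne
  obtain ⟨b, hb, hbG⟩ := hcomp.exists_isGreatest hne
  have hnull : μ μ.supportᶜ = 0 := Measure.measure_compl_support
  have hFa : cdf μ a = 0 := by
    have h0 : μ (Iio a) = 0 := measure_mono_null (fun x hx hxs => (haL hxs).not_gt hx) hnull
    rw [cdf_eq_real, measureReal_congr Iio_ae_eq_Iic.symm, measureReal_def, h0,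
      ENNReal.toReal_zero]
  have hFb : cdf μ b = 1 := by
    have h0 : μ (Iic b)ᶜ = 0 := measure_mono_null (fun x hx hxs => hx (hbG hxs)) hnull
    rw [cdf_eq_real, measureReal_def, (prob_compl_eq_zero_iff measurableSet_Iic).1 h0,
      ENNReal.toReal_one]
  have hq := cdf_quantileOf hα (continuous_cdf_of_nullSingleton (μ := μ)).continuousAt
  have hmono := monotone_cdf μ
  refine interior_mono (hord.out ha hb) ?_
  rw [interior_Icc]
  constructor
  · by_contra! hc
    linarith [hmono hc, hα.1]
  · by_contra! hc
    linarith [hmono hc, hα.2]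

/-- The derivative of a quantile along a family of distribution functions that has a linear
expansion in local coordinates at `q`. -/
theorem tendsto_quantileOf_slope {ι : Type*} {l : Filter ι} {μ : ι → Measure ℝ} {t : ι → ℝ}
    (ht : ∀ᶠ i in l, 0 < t i) {A B : ℝ} (hA : 0 < A) (hα : α ∈ Ioo (0 : ℝ) 1)
    (h : ∀ s : ℝ, Tendsto (fun i => (cdf (μ i) (q + t i * s) - α) / t i) l (𝓝 (s * A - B))) :
    Tendsto (fun i => (quantileOf (cdf (μ i)) α - q) / t i) l (𝓝 (B / A)) := by
  refine tendsto_order.2 ⟨fun a ha => ?_, fun a ha => ?_⟩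
  -- For `s` below `B / A` the limit `s A - B` is negative. The distribution function at `q + t s`
  -- is then eventually below `α`, which forces the quantile to be at least `q + t s`.
  · obtain ⟨s, has, hs⟩ := exists_between ha
    have hs' : s * A - B < 0 := by rw [lt_div_iff₀ hA] at hs; linarith
    filter_upwards [(h s).eventually (gt_mem_nhds hs'), ht] with i hi hti
    have hi : cdf (μ i) (q + t i * s) < α := by
      by_contra! hc
      exact hi.not_ge (div_nonneg (sub_nonneg.2 hc) hti.le)
    have := le_quantileOf_cdf hα.2 hi
    refine has.trans_le ?_
    rw [le_div_iff₀ hti]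
    linarith
  · obtain ⟨s, hs, has⟩ := exists_between ha
    have hs' : 0 < s * A - B := by rw [div_lt_iff₀ hA] at hs; linarith
    filter_upwards [(h s).eventually (lt_mem_nhds hs'), ht] with i hi hti
    rw [div_pos_iff_of_pos_right hti, sub_pos] at hi
    have := quantileOf_cdf_le hα.1 hi.le
    refine lt_of_le_of_lt ?_ has
    rw [div_le_iff₀ hti]
    linarith

end Quantile

/-- A derivative already known to exist is determined by right-hand slopes, the only ones that the
expansion for `δ ↓ 0` controls. -/
theorem derivWithin_eq_of_tendsto_right {φ : ℝ → ℝ} {S : Set ℝ} {d L : ℝ}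
    [(𝓝[S ∩ Ioi d] d).NeBot] (hφ : DifferentiableWithinAt ℝ φ S d)
    (h : Tendsto (fun d' => (φ d' - φ d) / (d' - d)) (𝓝[S ∩ Ioi d] d) (𝓝 L)) :
    derivWithin φ S d = L := by
  have h1 := hasDerivWithinAt_iff_tendsto_slope.1 hφ.hasDerivWithinAt
  have h2 := h1.mono_left (nhdsWithin_mono d fun x (hx : x ∈ S ∩ Ioi d) =>
    (⟨hx.1, ne_of_gt hx.2⟩ : x ∈ S \ {d}))
  refine tendsto_nhds_unique h2 (h.congr fun d' => ?_)
  rw [slope_def_field]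

/-! ### The model: measurability, densities and the unconditional quantile effect -/

namespace PolicyModel

variable {Ω E : Type*} [MeasurableSpace Ω] [MeasurableSpace E] {k : ℕ} {P : Measure Ω}
  {M : PolicyModel Ω E k}

theorem Structural.measurable_DX (hS : M.Structural P) : Measurable M.DX :=
  hS.measurable_D.prodMk hS.measurable_X

theorem Structural.measurable_section (hS : M.Structural P) (d : ℝ) (x : Fin k → ℝ) :
    Measurable (M.m d x) :=
  hS.measurable_m.comp (measurable_const.prodMk (measurable_const.prodMk measurable_id))

theorem Structural.measurable_Y (hS : M.Structural P) : Measurable M.Y :=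
  hS.measurable_m.comp (hS.measurable_D.prodMk (hS.measurable_X.prodMk hS.measurable_ε))

theorem Structural.measurable_Yt (hS : M.Structural P) {t : ℝ} (ht : t ∈ Icc (0 : ℝ) 1) :
    Measurable (M.Yt t) :=
  hS.measurable_m.comp (((hS.measurable_π t ht).comp hS.measurable_D).prodMk
    (hS.measurable_X.prodMk hS.measurable_ε))

theorem FYDX_eq (hS : M.Structural P) (hκ : M.IsCondLaw P) (y d : ℝ) (x : Fin k → ℝ) :
    M.FYDX y d x = (M.κ (d, x)).real {e | M.m d x e ≤ y} := by
  have := hκ.isMarkov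
  have hm := hS.measurable_section d x
  have : IsProbabilityMeasure (M.condLawY d x) := Measure.isProbabilityMeasure_map hm.aemeasurable
  rw [FYDX, cdf_eq_real, condLawY, map_measureReal_apply hm measurableSet_Iic]
  rfl

theorem cdf_map_eq [IsProbabilityMeasure P] {V : Ω → ℝ} (hV : Measurable V) (y : ℝ) :
    cdf (P.map V) y = P.real {ω | V ω ≤ y} := by
  have : IsProbabilityMeasure (P.map V) := Measure.isProbabilityMeasure_map hV.aemeasurable
  rw [cdf_eq_real, map_measureReal_apply hV measurableSet_Iic]
  rfl

theorem Regular.measurable_mdot_comp (hR : M.Regular P) (hS : M.Structural P) :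
    Measurable (fun ω => M.mdot (M.D ω) (M.X ω) (M.ε ω)) :=
  hR.measurable_mdot.comp (hS.measurable_D.prodMk (hS.measurable_X.prodMk hS.measurable_ε))

theorem Regular.exists_dominatedDensity (hR : M.Regular P) :
    ∃ (f : ℝ → ℝ → ℝ) (g : ℝ → ℝ) (C : ℝ), ∀ y ∈ interior (M.suppY P), IsDominatedDensityAt
      (P.map fun ω => (M.Y ω, M.mdot (M.D ω) (M.X ω) (M.ε ω))) f g C y := by
  obtain ⟨f, g, C, hf, hf0, heq, hc, hg, hzg, -, hle⟩ := hR.density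
  exact ⟨f, g, C, fun y hy => ⟨hf, hf0, heq,
    fun z => (hc z).continuousAt (isOpen_interior.mem_nhds hy), hg, hzg, hle⟩⟩

theorem CondRegular.exists_dominatedDensity (hR : M.CondRegular P) :
    ∃ (g : ℝ → ℝ) (C : ℝ), 0 < C ∧ Integrable g ∧ Integrable (fun z => z * g z) ∧
      ∀ d ∈ M.suppD P, ∀ x ∈ M.suppX P, ∃ f : ℝ → ℝ → ℝ, ∀ y ∈ interior (M.suppY P),
        IsDominatedDensityAt (M.condLawYdm d x) f g C y := by
  obtain ⟨g, C, hg, hzg, hC, h⟩ := hR.density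
  refine ⟨g, C, hC, hg, hzg, fun d hd x hx => ?_⟩
  obtain ⟨f, hf, hf0, heq, hc, hle⟩ := h d hd x hx
  exact ⟨f, fun y hy => ⟨hf, hf0, heq,
    fun z => (hc z).continuousAt (isOpen_interior.mem_nhds hy), hg, hzg, hle⟩⟩

theorem absolutelyContinuous_map_Y (hS : M.Structural P) (hR : M.Regular P) :
    P.map M.Y ≪ volume := by
  obtain ⟨f, g, C, hf, hf0, heq, -, -⟩ := hR.density
  have h1 : (P.map fun ω => (M.Y ω, M.mdot (M.D ω) (M.X ω) (M.ε ω))) ≪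
      (volume : Measure (ℝ × ℝ)) := by
    rw [heq]; exact withDensity_absolutelyContinuous _ _
  have h2 := (h1.map measurable_fst).trans
    Measure.quasiMeasurePreserving_fst.absolutelyContinuous
  rwa [Measure.map_map measurable_fst (hS.measurable_Y.prodMk (hR.measurable_mdot_comp hS))] at h2

theorem q_mem_interior_suppY [IsProbabilityMeasure P] (hS : M.Structural P) (hR : M.Regular P)
    (hcompact : IsCompact (M.suppY P)) (hinterval : (M.suppY P).OrdConnected) {τ : ℝ}
    (hτ : τ ∈ Ioo (0 : ℝ) 1) :
    M.q P τ ∈ interior (M.suppY P) ∧ M.FY P (M.q P τ) = τ := by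
  have : IsProbabilityMeasure (P.map M.Y) :=
    Measure.isProbabilityMeasure_map hS.measurable_Y.aemeasurable
  have : NullSingletonClass (P.map M.Y) :=
    ⟨fun x => absolutelyContinuous_map_Y hS hR (by simp)⟩
  exact ⟨quantileOf_cdf_mem_interior_support hcompact hinterval hτ,
    cdf_quantileOf hτ continuous_cdf_of_nullSingleton.continuousAt⟩

theorem hasDerivAt_FY [IsProbabilityMeasure P] (hS : M.Structural P) (hR : M.Regular P)
    {f : ℝ → ℝ → ℝ} {g : ℝ → ℝ} {C y : ℝ}
    (h : IsDominatedDensityAt (P.map fun ω => (M.Y ω, M.mdot (M.D ω) (M.X ω) (M.ε ω))) f g C y) :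
    HasDerivAt (M.FY P) (∫ z, f y z) y := by
  have hm := hR.measurable_mdot_comp hS
  have : IsProbabilityMeasure (P.map fun ω => (M.Y ω, M.mdot (M.D ω) (M.X ω) (M.ε ω))) :=
    Measure.isProbabilityMeasure_map (hS.measurable_Y.prodMk hm).aemeasurable
  refine h.hasDerivAt_marginal.congr_of_eventuallyEq (Eventually.of_forall fun y' => ?_)
  beta_reduce
  rw [FY, cdf_map_eq hS.measurable_Y,
    real_map_prodMk_le hS.measurable_Y hm (a := fun _ => y') measurable_const]

/-- The unconditional quantile effect, in terms of the joint density of `(Y, ṁ)`. -/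
theorem isQuantileMPE_of_density [IsProbabilityMeasure P] (hS : M.Structural P)
    (hR : M.Regular P) {τ : ℝ} (hτ : τ ∈ Ioo (0 : ℝ) 1) (hq : M.FY P (M.q P τ) = τ)
    {f : ℝ → ℝ → ℝ} {g : ℝ → ℝ} {C : ℝ}
    (h : IsDominatedDensityAt (P.map fun ω => (M.Y ω, M.mdot (M.D ω) (M.X ω) (M.ε ω))) f g C
      (M.q P τ)) (hpos : 0 < ∫ z, f (M.q P τ) z) :
    M.IsQuantileMPE P τ ((∫ z, z * f (M.q P τ) z) / ∫ z, f (M.q P τ) z) := by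
  refine tendsto_quantileOf_slope (μ := fun t => P.map (M.Yt t)) (t := fun t => t)
    self_mem_nhdsWithin hpos hτ fun s => ?_
  refine (h.tendsto_perturbation hS.measurable_Y (hR.measurable_mdot_comp hS)
    (W := M.Yt) hR.expansion s).congr' ?_
  filter_upwards [Ioo_mem_nhdsGT (zero_lt_one' ℝ)] with t ht
  rw [cdf_map_eq (hS.measurable_Yt ⟨ht.1.le, ht.2.le⟩), ← cdf_map_eq hS.measurable_Y]
  congr 2

/-! ### Derivatives in `d` of conditional distribution functions and quantiles -/

section Conditional

variable {d : ℝ} {x : Fin k → ℝ} {f : ℝ → ℝ → ℝ} {g : ℝ → ℝ} {C y : ℝ}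

theorem hasDerivAt_FYDX (hS : M.Structural P) (hκ : M.IsCondLaw P)
    (hm : Measurable (M.dm d x)) (h : IsDominatedDensityAt (M.condLawYdm d x) f g C y) :
    HasDerivAt (fun y' => M.FYDX y' d x) (∫ z, f y z) y := by
  have := hκ.isMarkov
  have hV := hS.measurable_section d x
  have : IsProbabilityMeasure (M.condLawYdm d x) :=
    Measure.isProbabilityMeasure_map (hV.prodMk hm).aemeasurable
  refine h.hasDerivAt_marginal.congr_of_eventuallyEq (Eventually.of_forall fun y' => ?_)
  beta_reduce
  rw [FYDX_eq hS hκ, condLawYdm,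
    real_map_prodMk_le hV hm (a := fun _ => y') measurable_const]

theorem fYDX_eq (hS : M.Structural P) (hκ : M.IsCondLaw P)
    (hm : Measurable (M.dm d x)) (h : IsDominatedDensityAt (M.condLawYdm d x) f g C y) :
    M.fYDX y d x = ∫ z, f y z :=
  (hasDerivAt_FYDX hS hκ hm h).deriv

theorem fYDX_nonneg (hS : M.Structural P) (hκ : M.IsCondLaw P)
    (hm : Measurable (M.dm d x)) (h : IsDominatedDensityAt (M.condLawYdm d x) f g C y) :
    0 ≤ M.fYDX y d x :=
  (fYDX_eq hS hκ hm h).symm ▸ h.integral_right_nonneg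

/-- By conditional independence `κ (d', x) = κ (d, x)`, so `F_{Y|D,X}(· | d', x)` is the
distribution function of `m(d + δ, x, ε)` under the fixed law `κ (d, x)`, with `δ = d' - d`. This is
a first-order perturbation of `m(d, x, ε)`. -/
theorem tendsto_FYDX_right (hS : M.Structural P) (hκ : M.IsCondLaw P) (hR : M.CondRegular P)
    (hCI : M.CondIndep P) (hd : d ∈ M.suppD P) (hx : x ∈ M.suppX P)
    (h : IsDominatedDensityAt (M.condLawYdm d x) f g C y) (s : ℝ) :
    Tendsto (fun d' => (M.FYDX (y + (d' - d) * s) d' x - M.FYDX y d x) / (d' - d))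
      (𝓝[M.suppD P ∩ Ioi d] d) (𝓝 (s * (∫ z, f y z) - ∫ z, z * f y z)) := by
  have := hκ.isMarkov
  obtain ⟨κ₀, hκ₀⟩ := hCI
  have h1 := h.tendsto_perturbation (hS.measurable_section d x) (hR.measurable_dm d hd x hx)
    (W := fun δ => M.m (d + δ) x) (hR.expansion d hd x hx) s
  have h2 : Tendsto (fun d' : ℝ => d' - d) (𝓝[M.suppD P ∩ Ioi d] d) (𝓝[>] 0) := by
    refine tendsto_nhdsWithin_iff.2 ⟨?_, ?_⟩
    · have : Tendsto (fun d' : ℝ => d' - d) (𝓝 d) (𝓝 (d - d)) :=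
        (continuous_sub_right d).tendsto d
      rw [sub_self] at this
      exact this.mono_left nhdsWithin_le_nhds
    · filter_upwards [self_mem_nhdsWithin] with d' hd'
      exact mem_Ioi.2 (sub_pos.2 hd'.2)
  refine (h1.comp h2).congr' ?_
  filter_upwards [self_mem_nhdsWithin] with d' hd'
  simp only [Function.comp_def, add_sub_cancel]
  rw [FYDX_eq hS hκ, FYDX_eq hS hκ, hκ₀ d hd x hx, hκ₀ d' hd'.1 x hx]

/-- The distribution derivative equals minus the density-weighted average structural derivative
at points of `supp D` that are accumulated from the right. -/
theorem dFYDX_eq (hS : M.Structural P) (hκ : M.IsCondLaw P) (hR : M.CondRegular P)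
    (hCI : M.CondIndep P) (hd : d ∈ M.suppD P) (hx : x ∈ M.suppX P)
    [(𝓝[M.suppD P ∩ Ioi d] d).NeBot]
    (h : IsDominatedDensityAt (M.condLawYdm d x) f g C y) :
    M.dFYDX P y d x = -∫ z, z * f y z := by
  refine derivWithin_eq_of_tendsto_right (hR.differentiable_d y x hx d hd) ?_
  simpa using tendsto_FYDX_right hS hκ hR hCI hd hx h 0

/-- The marginal density is continuous, so it stays positive near `y` and all nearby points belong
to the support. -/
theorem mem_interior_support_condLawY (hS : M.Structural P) (hκ : M.IsCondLaw P)
    (hm : Measurable (M.dm d x)) (hy : y ∈ interior (M.suppY P))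
    (h : ∀ y ∈ interior (M.suppY P), IsDominatedDensityAt (M.condLawYdm d x) f g C y)
    (hpos : 0 < ∫ z, f y z) : y ∈ interior (M.condLawY d x).support := by
  have := hκ.isMarkov
  have : IsProbabilityMeasure (M.condLawY d x) :=
    Measure.isProbabilityMeasure_map (hS.measurable_section d x).aemeasurable
  rw [mem_interior_iff_mem_nhds]
  filter_upwards [isOpen_interior.mem_nhds hy,
    (h y hy).continuousAt_integral_right.eventually (lt_mem_nhds hpos)] with y' hy' hpos'
  exact mem_support_of_hasDerivAt_cdf (hasDerivAt_FYDX hS hκ hm (h y' hy')) hpos'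

/-- The level `F_{Y|D,X}(y | d, x)` is held fixed while `d'` moves; at `d` its quantile is `y`, so
`tendsto_quantileOf_slope` applies around `y`. -/
theorem βCQD_eq (hS : M.Structural P) (hκ : M.IsCondLaw P) (hR : M.CondRegular P)
    (hCI : M.CondIndep P) (hd : d ∈ M.suppD P) (hx : x ∈ M.suppX P)
    [(𝓝[M.suppD P ∩ Ioi d] d).NeBot] (hy : y ∈ interior (M.suppY P))
    (h : ∀ y ∈ interior (M.suppY P), IsDominatedDensityAt (M.condLawYdm d x) f g C y)
    (hpos : 0 < ∫ z, f y z) :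
    M.βCQD P (M.FYDX y d x) d x = (∫ z, z * f y z) / ∫ z, f y z := by
  have hder := hasDerivAt_FYDX hS hκ (hR.measurable_dm d hd x hx) (h y hy)
  have hα : M.FYDX y d x ∈ Ioo (0 : ℝ) 1 ∧ M.QYDX (M.FYDX y d x) d x = y := by
    have : M.FYDX y d x ∈ ({α | α ∈ Ioo (0 : ℝ) 1 ∧ quantileOf (cdf (M.condLawY d x)) α = y}) := by
      rw [setOf_quantileOf_eq_of_hasDerivAt hder hpos]
      rfl
    exact this
  refine derivWithin_eq_of_tendsto_right (hR.differentiable_Q d hd x hx _ hα.1 ?_) ?_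
  · rw [hα.2]
    exact mem_interior_support_condLawY hS hκ (hR.measurable_dm d hd x hx) hy h hpos
  · rw [hα.2]
    refine tendsto_quantileOf_slope (μ := fun d' => M.condLawY d' x) (t := fun d' => d' - d) ?_
      hpos hα.1 fun s => tendsto_FYDX_right hS hκ hR hCI hd hx (h y hy) s
    filter_upwards [self_mem_nhdsWithin] with d' hd'
    exact sub_pos.2 hd'.2

theorem matchSet_eq (hS : M.Structural P) (hκ : M.IsCondLaw P) (hm : Measurable (M.dm d x))
    {τ : ℝ} (h : IsDominatedDensityAt (M.condLawYdm d x) f g C (M.q P τ))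
    (hpos : 0 < ∫ z, f (M.q P τ) z) :
    M.matchSet P τ d x = {M.FYDX (M.q P τ) d x} :=
  setOf_quantileOf_eq_of_hasDerivAt (hasDerivAt_FYDX hS hκ hm h) hpos

theorem ζ_eq (hS : M.Structural P) (hκ : M.IsCondLaw P) (hm : Measurable (M.dm d x))
    {τ : ℝ} (h : IsDominatedDensityAt (M.condLawYdm d x) f g C (M.q P τ))
    (hpos : 0 < ∫ z, f (M.q P τ) z) :
    M.ζ P τ d x = M.FYDX (M.q P τ) d x := by
  rw [ζ, matchSet_eq hS hκ hm h hpos, csSup_singleton]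

end Conditional

/-! ### Averaging over the law of `(D, X)` -/

/-- The points of a real set that are isolated from the right within it are countable, and `D` has
no atoms. -/
theorem ae_mem_support [IsProbabilityMeasure P] (hS : M.Structural P) :
    ∀ᵐ p ∂(P.map M.DX), p.1 ∈ M.suppD P ∧ p.2 ∈ M.suppX P ∧
      (𝓝[M.suppD P ∩ Ioi p.1] p.1).NeBot := by
  have h1 : ∀ᵐ d ∂(P.map M.D), d ∈ M.suppD P := Measure.support_mem_ae
  have h2 : ∀ᵐ x ∂(P.map M.X), x ∈ M.suppX P := Measure.support_mem_ae
  have h3 : ∀ᵐ d ∂(P.map M.D), d ∉ {d ∈ M.suppD P | 𝓝[M.suppD P ∩ Ioi d] d = ⊥} := by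
    have : NullSingletonClass (P.map M.D) := ⟨fun d => by
      rw [Measure.map_apply hS.measurable_D (measurableSet_singleton d)]
      exact hS.continuous_D d⟩
    exact compl_mem_ae_iff.2 (countable_setOfPred_isolated_right_within.measure_zero _)
  have hD : P.map M.D = (P.map M.DX).map Prod.fst := by
    rw [Measure.map_map measurable_fst hS.measurable_DX]; rfl
  have hX : P.map M.X = (P.map M.DX).map Prod.snd := by
    rw [Measure.map_map measurable_snd hS.measurable_DX]; rfl
  rw [hD] at h1 h3
  rw [hX] at h2
  filter_upwards [ae_of_ae_map measurable_fst.aemeasurable h1,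
    ae_of_ae_map measurable_snd.aemeasurable h2,
    ae_of_ae_map measurable_fst.aemeasurable h3] with p hp1 hp2 hp3
  exact ⟨hp1, hp2, ⟨fun h => hp3 ⟨hp1, h⟩⟩⟩

theorem integral_kernel_eq [IsProbabilityMeasure P] (hS : M.Structural P) (hκ : M.IsCondLaw P)
    {S : Set ((ℝ × (Fin k → ℝ)) × E)} (hm : MeasurableSet S) :
    Integrable (fun p => (M.κ p).real {e | (p, e) ∈ S}) (P.map M.DX) ∧
    P.real {ω | (M.DX ω, M.ε ω) ∈ S} = ∫ p, (M.κ p).real {e | (p, e) ∈ S} ∂(P.map M.DX) := by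
  have := hκ.isMarkov
  have : IsProbabilityMeasure (P.map M.DX) :=
    Measure.isProbabilityMeasure_map hS.measurable_DX.aemeasurable
  have hmeas : Measurable (fun p => M.κ p {e | (p, e) ∈ S}) :=
    Kernel.measurable_kernel_prodMk_left hm
  refine ⟨?_, ?_⟩
  · refine Integrable.of_bound hmeas.ennreal_toReal.aestronglyMeasurable 1
      (ae_of_all _ fun p => ?_)
    rw [Real.norm_of_nonneg measureReal_nonneg]
    exact measureReal_le_one
  · have h1 : P {ω | (M.DX ω, M.ε ω) ∈ S} = (P.map fun ω => (M.DX ω, M.ε ω)) S := by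
      rw [Measure.map_apply (hS.measurable_DX.prodMk hS.measurable_ε) hm]; rfl
    rw [measureReal_def, h1, hκ.map_eq, Measure.compProd_apply hm]
    exact (integral_toReal hmeas.aemeasurable (ae_of_all _ fun p => measure_lt_top _ _)).symm

/-- The average of the distribution derivatives, weighted by the policy direction, is minus the
density-weighted mean of `ṁ`. -/
theorem integral_πdot_mul_dFYDX [IsProbabilityMeasure P] (hS : M.Structural P)
    (hκ : M.IsCondLaw P) (hR1 : M.Regular P)
    (hR2 : M.CondRegular P) (hCI : M.CondIndep P) {q : ℝ} (hq : q ∈ interior (M.suppY P))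
    {f : ℝ → ℝ → ℝ} {g : ℝ → ℝ} {C : ℝ}
    (h : IsDominatedDensityAt (P.map fun ω => (M.Y ω, M.mdot (M.D ω) (M.X ω) (M.ε ω))) f g C q) :
    Integrable (fun p : ℝ × (Fin k → ℝ) => M.πdot p.1 * M.dFYDX P q p.1 p.2) (P.map M.DX) ∧
      ∫ p, M.πdot p.1 * M.dFYDX P q p.1 p.2 ∂(P.map M.DX) = -∫ z, z * f q z := by
  have := hκ.isMarkov
  have : IsProbabilityMeasure (P.map M.DX) :=
    Measure.isProbabilityMeasure_map hS.measurable_DX.aemeasurable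
  have hmdot := hR1.measurable_mdot_comp hS
  have : IsProbabilityMeasure (P.map fun ω => (M.Y ω, M.mdot (M.D ω) (M.X ω) (M.ε ω))) :=
    Measure.isProbabilityMeasure_map (hS.measurable_Y.prodMk hmdot).aemeasurable
  obtain ⟨K, hK⟩ := hS.bounded_πdot
  obtain ⟨g', C', hC', hg', hzg', hdens⟩ := hR2.exists_dominatedDensity
  have hassoc : Measurable (fun z : (ℝ × (Fin k → ℝ)) × E => (z.1.1, z.1.2, z.2)) := by fun_prop
  have hm1 : Measurable (fun z : (ℝ × (Fin k → ℝ)) × E => M.m z.1.1 z.1.2 z.2) :=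
    hS.measurable_m.comp hassoc
  have hm2 : Measurable (fun z : (ℝ × (Fin k → ℝ)) × E => M.mdot z.1.1 z.1.2 z.2) :=
    hR1.measurable_mdot.comp hassoc
  have hset (t : ℝ) : MeasurableSet {z : (ℝ × (Fin k → ℝ)) × E |
      M.m z.1.1 z.1.2 z.2 ≤ q + t * -M.mdot z.1.1 z.1.2 z.2} :=
    measurableSet_le hm1 ((hm2.neg.const_mul t).const_add q)
  have hset0 : MeasurableSet {z : (ℝ × (Fin k → ℝ)) × E | M.m z.1.1 z.1.2 z.2 ≤ q} :=
    measurableSet_le hm1 measurable_const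
  -- Difference quotient of the conditional probability of `Y ≤ q - t ṁ`. At fixed `(d, x)` the
  -- shift is `-t π̇(d) z` with `z = ∂_d m`, so its limit is `-π̇(d) ∫ z f' q z`, that is, `π̇(d)
  -- ∂_d F_{Y|D,X}`.
  let Φ (t : ℝ) (p : ℝ × (Fin k → ℝ)) : ℝ :=
    ((M.κ p).real {e | M.m p.1 p.2 e ≤ q + t * -M.mdot p.1 p.2 e} -
      (M.κ p).real {e | M.m p.1 p.2 e ≤ q}) / t
  have hΦint (t : ℝ) : Integrable (Φ t) (P.map M.DX) :=
    ((integral_kernel_eq hS hκ (hset t)).1.sub (integral_kernel_eq hS hκ hset0).1).div_const t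
  have hΦ (t : ℝ) : ∫ p, Φ t p ∂(P.map M.DX) =
      (P.real {ω | M.Y ω ≤ q + t * -M.mdot (M.D ω) (M.X ω) (M.ε ω)} -
        P.real {ω | M.Y ω ≤ q}) / t := by
    refine (integral_div _ _).trans ?_
    congr 1
    exact (integral_sub (integral_kernel_eq hS hκ (hset t)).1
      (integral_kernel_eq hS hκ hset0).1).trans (congrArg₂ (· - ·)
        (integral_kernel_eq hS hκ (hset t)).2.symm (integral_kernel_eq hS hκ hset0).2.symm)
  have hshift {d : ℝ} {x : Fin k → ℝ} (hdm : Measurable (M.dm d x)) (t : ℝ) :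
      Φ t (d, x) = ((M.condLawYdm d x).real {p | p.1 ≤ q + t * -(M.πdot d * p.2)} -
        (M.condLawYdm d x).real {p | p.1 ≤ q}) / t := by
    rw [condLawYdm, real_map_prodMk_le (hS.measurable_section d x) hdm
        (a := fun z => q + t * -(M.πdot d * z)) (by fun_prop),
      real_map_prodMk_le (hS.measurable_section d x) hdm (a := fun _ => q) measurable_const]
    rfl
  have hprob {d : ℝ} {x : Fin k → ℝ} (hdm : Measurable (M.dm d x)) :
      IsProbabilityMeasure (M.condLawYdm d x) :=
    Measure.isProbabilityMeasure_map ((hS.measurable_section d x).prodMk hdm).aemeasurable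
  have hbg (c : ℝ) : Integrable (fun z => -(c * z) * g' z) := by
    refine (hzg'.const_mul (-c)).congr (ae_of_all _ fun z => ?_)
    ring
  have hbound : ∀ᵐ p ∂(P.map M.DX), ∀ t > 0,
      ‖Φ t p‖ ≤ C' * (K * ∫ z, ‖z * g' z‖) := by
    filter_upwards [ae_mem_support hS]
    rintro ⟨d, x⟩ ⟨hd, hx, -⟩ t ht
    have hdm := hR2.measurable_dm d hd x hx
    have := hprob hdm
    obtain ⟨f', hf'⟩ := hdens d hd x hx
    have h1 := (hf' q hq).abs_shift_sub_le (b := fun z => -(M.πdot d * z)) (by fun_prop)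
      (hbg _) t
    have h2 : ∫ z, ‖-(M.πdot d * z) * g' z‖ = |M.πdot d| * ∫ z, ‖z * g' z‖ := by
      rw [← integral_const_mul]
      congr 1 with z
      rw [norm_mul, norm_neg, norm_mul, norm_mul, Real.norm_eq_abs (M.πdot d), mul_assoc]
    rw [hshift hdm, norm_div, Real.norm_eq_abs, Real.norm_eq_abs, div_le_iff₀ (abs_pos.2 ht.ne'),
      mul_comm (C' * _)]
    refine h1.trans ?_
    rw [h2]
    gcongr
    exact hK d
  have hlim : ∀ᵐ p ∂(P.map M.DX), Tendsto (fun t => Φ t p) (𝓝[>] 0)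
      (𝓝 (M.πdot p.1 * M.dFYDX P q p.1 p.2)) := by
    filter_upwards [ae_mem_support hS]
    rintro ⟨d, x⟩ ⟨hd, hx, hacc⟩
    have hdm := hR2.measurable_dm d hd x hx
    have := hprob hdm
    obtain ⟨f', hf'⟩ := hdens d hd x hx
    have h1 := ((hf' q hq).tendsto_shift (b := fun z => -(M.πdot d * z)) (by fun_prop)
      (hbg _)).mono_left (nhdsWithin_mono _ fun t (ht : 0 < t) => ne_of_gt ht)
    have h2 : ∫ z, -(M.πdot d * z) * f' q z = M.πdot d * M.dFYDX P q d x := by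
      rw [dFYDX_eq hS hκ hR2 hCI hd hx (hf' q hq), ← integral_neg, ← integral_const_mul]
      congr 1 with z
      ring
    rw [h2] at h1
    exact h1.congr fun t => (hshift hdm t).symm
  -- Measurability in `(d, x)` comes from the limit: the conditional densities are given separately
  -- for each `(d, x)`, with no joint measurability.
  have hmeas : AEStronglyMeasurable
      (fun p : ℝ × (Fin k → ℝ) => M.πdot p.1 * M.dFYDX P q p.1 p.2) (P.map M.DX) :=
    aestronglyMeasurable_of_tendsto_ae (𝓝[>] (0 : ℝ)) (fun t => (hΦint t).aestronglyMeasurable) hlim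
  refine ⟨Integrable.of_bound hmeas (C' * (K * ∫ z, ‖z * g' z‖)) ?_, ?_⟩
  · filter_upwards [hbound, hlim] with p hp1 hp2
    refine le_of_tendsto hp2.norm ?_
    filter_upwards [self_mem_nhdsWithin] with t ht using hp1 t ht
  · have h1 : Tendsto (fun t => ∫ p, Φ t p ∂(P.map M.DX)) (𝓝[>] 0)
        (𝓝 (∫ p, M.πdot p.1 * M.dFYDX P q p.1 p.2 ∂(P.map M.DX))) := by
      refine tendsto_integral_filter_of_dominated_convergence _
        (Eventually.of_forall fun t => (hΦint t).aestronglyMeasurable) ?_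
        (integrable_const (C' * (K * ∫ z, ‖z * g' z‖))) hlim
      filter_upwards [self_mem_nhdsWithin] with t ht
      filter_upwards [hbound] with p hp using hp t ht
    -- The same limit, computed from the joint density of `(Y, ṁ)`.
    have h2 := (h.tendsto_shift (b := fun z => -z) (by fun_prop)
      (by simpa using h.integrable_mul_g.neg)).mono_left
        (nhdsWithin_mono _ fun t (ht : 0 < t) => ne_of_gt ht)
    simp only [neg_mul, integral_neg] at h2
    refine tendsto_nhds_unique h1 (h2.congr fun t => ?_)
    rw [hΦ, real_map_prodMk_le hS.measurable_Y hmdot (a := fun z => q + t * -z) (by fun_prop),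
      real_map_prodMk_le hS.measurable_Y hmdot (a := fun _ => q) measurable_const]

/-- The window densities of `Y` around `q` on the events `(D, X) ∈ B`. -/
theorem tendsto_window_DX [IsProbabilityMeasure P] (hS : M.Structural P) (hκ : M.IsCondLaw P)
    (hR2 : M.CondRegular P) {q : ℝ} (hq : q ∈ interior (M.suppY P)) :
    Integrable (fun p : ℝ × (Fin k → ℝ) => M.fYDX q p.1 p.2) (P.map M.DX) ∧
    ∀ B : Set (ℝ × (Fin k → ℝ)), MeasurableSet B →
      Tendsto (fun t : ℝ => P.real (M.Y ⁻¹' Icc (q - t) (q + t) ∩ M.DX ⁻¹' B) / (2 * t)) (𝓝[>] 0)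
        (𝓝 (∫ p in B, M.fYDX q p.1 p.2 ∂(P.map M.DX))) := by
  have := hκ.isMarkov
  have : IsProbabilityMeasure (P.map M.DX) :=
    Measure.isProbabilityMeasure_map hS.measurable_DX.aemeasurable
  obtain ⟨g', C', hC', hg', hzg', hdens⟩ := hR2.exists_dominatedDensity
  have hm1 : Measurable (fun z : (ℝ × (Fin k → ℝ)) × E => M.m z.1.1 z.1.2 z.2) :=
    hS.measurable_m.comp (by fun_prop :
      Measurable (fun z : (ℝ × (Fin k → ℝ)) × E => (z.1.1, z.1.2, z.2)))
  have hset (t : ℝ) {B : Set (ℝ × (Fin k → ℝ))} (hB : MeasurableSet B) :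
      MeasurableSet {z : (ℝ × (Fin k → ℝ)) × E |
        M.m z.1.1 z.1.2 z.2 ∈ Icc (q - t) (q + t) ∧ z.1 ∈ B} :=
    (hm1 measurableSet_Icc).inter (measurable_fst hB)
  -- Conditional window probability per unit length: it converges to the conditional density at `q`
  -- and is bounded uniformly in `(d, x)` and `t > 0`.
  let Φ (t : ℝ) (p : ℝ × (Fin k → ℝ)) : ℝ :=
    (M.κ p).real {e | M.m p.1 p.2 e ∈ Icc (q - t) (q + t)} / (2 * t)
  have hΦint (t : ℝ) : Integrable (Φ t) (P.map M.DX) := by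
    simpa [Φ] using (integral_kernel_eq hS hκ (hset t MeasurableSet.univ)).1.div_const (2 * t)
  have hshift {d : ℝ} {x : Fin k → ℝ} (hdm : Measurable (M.dm d x)) (t : ℝ) :
      Φ t (d, x) = (M.condLawYdm d x).real {p | p.1 ∈ Icc (q - t) (q + t)} / (2 * t) := by
    have hI : MeasurableSet {p : ℝ × ℝ | p.1 ∈ Icc (q - t) (q + t)} :=
      measurable_fst measurableSet_Icc
    rw [condLawYdm, map_measureReal_apply ((hS.measurable_section d x).prodMk hdm) hI]
    rfl
  have hprob {d : ℝ} {x : Fin k → ℝ} (hdm : Measurable (M.dm d x)) :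
      IsProbabilityMeasure (M.condLawYdm d x) :=
    Measure.isProbabilityMeasure_map ((hS.measurable_section d x).prodMk hdm).aemeasurable
  have hbound : ∀ᵐ p ∂(P.map M.DX), ∀ t > 0, ‖Φ t p‖ ≤ C' * ∫ z, ‖g' z‖ := by
    filter_upwards [ae_mem_support hS]
    rintro ⟨d, x⟩ ⟨hd, hx, -⟩ t ht
    have hdm := hR2.measurable_dm d hd x hx
    have := hprob hdm
    obtain ⟨f', hf'⟩ := hdens d hd x hx
    rw [hshift hdm, Real.norm_of_nonneg (by positivity), div_le_iff₀ (by positivity), mul_comm]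
    exact (hf' q hq).real_window_le ht
  have hlim : ∀ᵐ p ∂(P.map M.DX), Tendsto (fun t => Φ t p) (𝓝[>] 0)
      (𝓝 (M.fYDX q p.1 p.2)) := by
    filter_upwards [ae_mem_support hS]
    rintro ⟨d, x⟩ ⟨hd, hx, -⟩
    have hdm := hR2.measurable_dm d hd x hx
    have := hprob hdm
    obtain ⟨f', hf'⟩ := hdens d hd x hx
    have h2 : M.fYDX q d x = ∫ z, f' q z := fYDX_eq hS hκ hdm (hf' q hq)
    rw [h2]
    exact (hf' q hq).tendsto_window.congr fun t => (hshift hdm t).symm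
  have hmeas : AEStronglyMeasurable
      (fun p : ℝ × (Fin k → ℝ) => M.fYDX q p.1 p.2) (P.map M.DX) :=
    aestronglyMeasurable_of_tendsto_ae (𝓝[>] (0 : ℝ)) (fun t => (hΦint t).aestronglyMeasurable) hlim
  refine ⟨Integrable.of_bound hmeas (C' * ∫ z, ‖g' z‖) ?_, fun B hB => ?_⟩
  · filter_upwards [hbound, hlim] with p hp1 hp2
    refine le_of_tendsto hp2.norm ?_
    filter_upwards [self_mem_nhdsWithin] with t ht using hp1 t ht
  · have h1 : Tendsto (fun t => ∫ p in B, Φ t p ∂(P.map M.DX)) (𝓝[>] 0)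
        (𝓝 (∫ p in B, M.fYDX q p.1 p.2 ∂(P.map M.DX))) := by
      refine tendsto_integral_filter_of_dominated_convergence _
        (Eventually.of_forall fun t => (hΦint t).aestronglyMeasurable.restrict) ?_
        (integrable_const (C' * ∫ z, ‖g' z‖)) (ae_restrict_of_ae hlim)
      filter_upwards [self_mem_nhdsWithin] with t ht
      filter_upwards [ae_restrict_of_ae hbound] with p hp using hp t ht
    refine h1.congr fun t => ?_
    refine (integral_div _ _).trans ?_
    congr 1
    refine Eq.trans ?_ (integral_kernel_eq hS hκ (hset t hB)).2.symm
    rw [← integral_indicator hB]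
    congr 1 with p
    by_cases hp : p ∈ B <;> simp [hp]

/-- The matching identity between conditional quantile and distribution derivatives. -/
theorem fYDX_mul_βCQD {d : ℝ} {x : Fin k → ℝ} {f : ℝ → ℝ → ℝ} {g : ℝ → ℝ} {C τ : ℝ}
    (hS : M.Structural P) (hκ : M.IsCondLaw P) (hR : M.CondRegular P)
    (hCI : M.CondIndep P) (hd : d ∈ M.suppD P) (hx : x ∈ M.suppX P)
    [(𝓝[M.suppD P ∩ Ioi d] d).NeBot] (hq : M.q P τ ∈ interior (M.suppY P))
    (h : ∀ y ∈ interior (M.suppY P), IsDominatedDensityAt (M.condLawYdm d x) f g C y) :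
    M.fYDX (M.q P τ) d x * M.βCQD P (M.ζ P τ d x) d x = -M.dFYDX P (M.q P τ) d x := by
  have hdm := hR.measurable_dm d hd x hx
  have h1 := fYDX_eq hS hκ hdm (h _ hq)
  have h2 := fYDX_nonneg hS hκ hdm (h _ hq)
  rw [dFYDX_eq hS hκ hR hCI hd hx (h _ hq), neg_neg]
  -- Where the density vanishes both sides are `0`, whatever value `ζ` takes there.
  rcases h2.eq_or_lt with h0 | hpos
  · rw [← h0, zero_mul, (h _ hq).integral_id_mul_eq_zero (h1 ▸ h0.symm)]
  · have hpos' : 0 < ∫ z, f (M.q P τ) z := h1 ▸ hpos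
    rw [ζ_eq hS hκ hdm (h _ hq) hpos', βCQD_eq hS hκ hR hCI hd hx hq h hpos', h1,
      mul_div_cancel₀ _ hpos'.ne']

end PolicyModel

/-! ### The three forms of the quantile effect -/

open PolicyModel

theorem corollary2 {Ω E : Type*} [MeasurableSpace Ω] [MeasurableSpace E] {k : ℕ}
    (P : Measure Ω) [IsProbabilityMeasure P] (M : PolicyModel Ω E k)
    (hS : M.Structural P) (hκ : M.IsCondLaw P) (hR1 : M.Regular P) (hR2 : M.CondRegular P)
    (hCI : M.CondIndep P)
    (hcompact : IsCompact (M.suppY P)) (hinterval : (M.suppY P).OrdConnected)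
    (τ : ℝ) (hτ : τ ∈ Ioo (0 : ℝ) 1) :
    -- the matching function is well defined wherever its weight does not vanish
    (∀ d ∈ M.suppD P, ∀ x ∈ M.suppX P, M.weight P (M.q P τ) d x ≠ 0 →
      M.matchSet P τ d x = {M.ζ P τ d x}) ∧
    ∃ θ : ℝ, M.IsQuantileMPE P τ θ ∧
      -- first form
      (Integrable (fun p : ℝ × (Fin k → ℝ) => M.πdot p.1 * M.dFYDX P (M.q P τ) p.1 p.2)
          (P.map M.DX) ∧
        θ = (-1 / M.fY P (M.q P τ)) *
          ∫ p, M.πdot p.1 * M.dFYDX P (M.q P τ) p.1 p.2 ∂(P.map M.DX)) ∧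
      -- second form
      (Integrable (fun p : ℝ × (Fin k → ℝ) => M.πdot p.1 *
            (M.weight P (M.q P τ) p.1 p.2 * M.βCQD P (M.ζ P τ p.1 p.2) p.1 p.2))
          (P.map M.DX) ∧
        θ = ∫ p, M.πdot p.1 *
            (M.weight P (M.q P τ) p.1 p.2 * M.βCQD P (M.ζ P τ p.1 p.2) p.1 p.2)
          ∂(P.map M.DX)) ∧
      -- third form, with the conditional law of `(D, X)` given `Y = q_τ`
      ∃ ν : Measure (ℝ × (Fin k → ℝ)), IsCondLawAt P M.Y M.DX (M.q P τ) ν ∧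
        Integrable (fun p : ℝ × (Fin k → ℝ) =>
          M.πdot p.1 * M.βCQD P (M.ζ P τ p.1 p.2) p.1 p.2) ν ∧
        θ = ∫ p, M.πdot p.1 * M.βCQD P (M.ζ P τ p.1 p.2) p.1 p.2 ∂ν := by
  obtain ⟨hq, hFq⟩ := q_mem_interior_suppY hS hR1 hcompact hinterval hτ
  obtain ⟨f, g, C, hf⟩ := hR1.exists_dominatedDensity
  obtain ⟨g', C', hC', hg', hzg', hdens⟩ := hR2.exists_dominatedDensity
  have hprobDX : IsProbabilityMeasure (P.map M.DX) :=
    Measure.isProbabilityMeasure_map hS.measurable_DX.aemeasurable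
  have hfY : M.fY P (M.q P τ) = ∫ z, f (M.q P τ) z := (hasDerivAt_FY hS hR1 (hf _ hq)).deriv
  have hfYpos := hR1.pos_fY _ hq
  have hApos : 0 < ∫ z, f (M.q P τ) z := hfY ▸ hfYpos
  obtain ⟨hint1, heq1⟩ := integral_πdot_mul_dFYDX hS hκ hR1 hR2 hCI hq (hf _ hq)
  obtain ⟨hintw, hwin⟩ := tendsto_window_DX hS hκ hR2 hq
  have hθ := isQuantileMPE_of_density hS hR1 hτ hFq (hf _ hq) hApos
  rw [← hfY] at hθ
  refine ⟨fun d hd x hx hw => ?_, _, hθ, ⟨hint1, ?_⟩, ?_⟩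
  · obtain ⟨f', hf'⟩ := hdens d hd x hx
    have hdm := hR2.measurable_dm d hd x hx
    have h1 := fYDX_eq hS hκ hdm (hf' _ hq)
    have h2 := fYDX_nonneg hS hκ hdm (hf' _ hq)
    have hne : M.fYDX (M.q P τ) d x ≠ 0 := fun h0 => hw (by rw [weight, h0, zero_div])
    have hpos : 0 < ∫ z, f' (M.q P τ) z := h1 ▸ lt_of_le_of_ne h2 hne.symm
    rw [ζ_eq hS hκ hdm (hf' _ hq) hpos, matchSet_eq hS hκ hdm (hf' _ hq) hpos]
  · rw [heq1]
    ring
  have hae : (fun p : ℝ × (Fin k → ℝ) => M.πdot p.1 *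
      (M.weight P (M.q P τ) p.1 p.2 * M.βCQD P (M.ζ P τ p.1 p.2) p.1 p.2)) =ᵐ[P.map M.DX]
      fun p => (-1 / M.fY P (M.q P τ)) * (M.πdot p.1 * M.dFYDX P (M.q P τ) p.1 p.2) := by
    filter_upwards [ae_mem_support hS]
    rintro ⟨d, x⟩ ⟨hd, hx, hacc⟩
    obtain ⟨f', hf'⟩ := hdens d hd x hx
    have := fYDX_mul_βCQD hS hκ hR2 hCI hd hx hq hf'
    simp only [weight]
    rw [div_mul_eq_mul_div, this]
    ring
  have hint2 := (hint1.const_mul (-1 / M.fY P (M.q P τ))).congr hae.symm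
  have hval : (∫ z, z * f (M.q P τ) z) / M.fY P (M.q P τ) = ∫ p, M.πdot p.1 *
      (M.weight P (M.q P τ) p.1 p.2 * M.βCQD P (M.ζ P τ p.1 p.2) p.1 p.2) ∂(P.map M.DX) := by
    rw [integral_congr_ae hae, integral_const_mul, heq1]
    ring
  refine ⟨⟨hint2, hval⟩, ?_⟩
  let w : ℝ × (Fin k → ℝ) → ℝ := fun p => M.weight P (M.q P τ) p.1 p.2
  have hw : Integrable w (P.map M.DX) := hintw.div_const _
  have hw0 : ∀ᵐ p ∂(P.map M.DX), 0 ≤ w p := by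
    filter_upwards [ae_mem_support hS]
    rintro ⟨d, x⟩ ⟨hd, hx, -⟩
    obtain ⟨f', hf'⟩ := hdens d hd x hx
    exact div_nonneg
      (fYDX_nonneg hS hκ (hR2.measurable_dm d hd x hx) (hf' _ hq)) hfYpos.le
  have hwm : AEMeasurable (fun p => ENNReal.ofReal (w p)) (P.map M.DX) :=
    hw.aestronglyMeasurable.aemeasurable.ennreal_ofReal
  have hwfin : ∀ᵐ p ∂(P.map M.DX), ENNReal.ofReal (w p) < ⊤ :=
    ae_of_all _ fun _ => ENNReal.ofReal_lt_top
  -- Bayes' rule: conditioning on `Y = q_τ` reweights the law of `(D, X)` by `f_{Y|D,X} / f_Y`.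
  -- Points of zero weight become `ν`-null, so `ζ` is meaningful `ν`-almost everywhere.
  let ν : Measure (ℝ × (Fin k → ℝ)) := (P.map M.DX).withDensity fun p => ENNReal.ofReal (w p)
  have hνreal (B : Set (ℝ × (Fin k → ℝ))) (hB : MeasurableSet B) :
      ν.real B = ∫ p in B, w p ∂(P.map M.DX) := by
    rw [measureReal_def, withDensity_apply _ hB,
      integral_eq_lintegral_of_nonneg_ae (ae_restrict_of_ae hw0) hw.aestronglyMeasurable.restrict]
  have hden : Tendsto (fun t : ℝ => P.real (M.Y ⁻¹' Icc (M.q P τ - t) (M.q P τ + t)) / (2 * t))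
      (𝓝[>] 0) (𝓝 (M.fY P (M.q P τ))) := by
    have hmdot := hR1.measurable_mdot_comp hS
    have : IsProbabilityMeasure (P.map fun ω => (M.Y ω, M.mdot (M.D ω) (M.X ω) (M.ε ω))) :=
      Measure.isProbabilityMeasure_map (hS.measurable_Y.prodMk hmdot).aemeasurable
    rw [hfY]
    refine (hf _ hq).tendsto_window.congr fun t => ?_
    have hI : MeasurableSet {p : ℝ × ℝ | p.1 ∈ Icc (M.q P τ - t) (M.q P τ + t)} :=
      measurable_fst measurableSet_Icc
    rw [map_measureReal_apply (hS.measurable_Y.prodMk hmdot) hI]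
    rfl
  have hcond (B : Set (ℝ × (Fin k → ℝ))) (hB : MeasurableSet B) :
      Tendsto (fun h : ℝ => (ProbabilityTheory.cond P
        (M.Y ⁻¹' Icc (M.q P τ - h) (M.q P τ + h))).real (M.DX ⁻¹' B)) (𝓝[>] 0)
        (𝓝 (ν.real B)) := by
    have h1 : ν.real B = (∫ p in B, M.fYDX (M.q P τ) p.1 p.2 ∂(P.map M.DX)) /
        M.fY P (M.q P τ) := by
      rw [hνreal B hB]
      exact integral_div _ _
    rw [h1]
    refine ((hwin B hB).div hden hfYpos.ne').congr' ?_
    filter_upwards [self_mem_nhdsWithin] with t ht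
    rw [Pi.div_apply]
    have ht' : (2 * t : ℝ) ≠ 0 := mul_ne_zero two_ne_zero (ne_of_gt ht)
    rw [measureReal_def (ProbabilityTheory.cond P _),
      ProbabilityTheory.cond_apply (hS.measurable_Y measurableSet_Icc), ENNReal.toReal_mul,
      ENNReal.toReal_inv, div_div_div_cancel_right₀ ht', div_eq_inv_mul]
    rfl
  -- The total mass is a limit of conditional probabilities of the whole space, each equal to `1`
  -- once the window has positive probability, which `f_Y(q_τ) > 0` ensures.
  have hνuniv : ν.real univ = 1 := by
    refine tendsto_nhds_unique (hcond univ MeasurableSet.univ) (tendsto_const_nhds.congr' ?_)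
    filter_upwards [hden.eventually (lt_mem_nhds hfYpos), self_mem_nhdsWithin] with t ht ht0
    have hne : P (M.Y ⁻¹' Icc (M.q P τ - t) (M.q P τ + t)) ≠ 0 := by
      intro h0
      rw [measureReal_def, h0, ENNReal.toReal_zero, zero_div] at ht
      exact lt_irrefl _ ht
    have := ProbabilityTheory.cond_isProbabilityMeasure hne
    rw [preimage_univ, probReal_univ]
  have hνprob : IsProbabilityMeasure ν := ⟨(ENNReal.toReal_eq_one_iff _).1 hνuniv⟩
  have hsmul : (fun p : ℝ × (Fin k → ℝ) => (ENNReal.ofReal (w p)).toReal •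
      (M.πdot p.1 * M.βCQD P (M.ζ P τ p.1 p.2) p.1 p.2)) =ᵐ[P.map M.DX]
      fun p => M.πdot p.1 *
        (M.weight P (M.q P τ) p.1 p.2 * M.βCQD P (M.ζ P τ p.1 p.2) p.1 p.2) := by
    filter_upwards [hw0] with p hp
    rw [ENNReal.toReal_ofReal hp, smul_eq_mul]
    ring
  refine ⟨ν, ⟨hνprob, hcond⟩, ?_, ?_⟩
  · rw [integrable_withDensity_iff_integrable_smul₀' hwm hwfin]
    exact hint2.congr hsmul.symm
  · rw [hval, integral_withDensity_eq_integral_toReal_smul₀ hwm hwfin]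
    exact (integral_congr_ae hsmul).symm
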